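/- Let $M$ be a finite matroid of rank $r$ on a ground set $X$ and let $R\subseteq X$. For an integer $a\ge 0$ let $B(M,R,a)$ be the number of bases $A$ of $M$ with $|A\cap R|=a$, and for $0\le a\le r$ put $P(M,R,a)=B(M,R,a)\big/\binom{r}{a}$. For a non-loop $x$ let $\mathrm{Par}_M(x)$ be the parallel class of $x$, consisting of $x$ and all non-loops $y$ such that $\{x,y\}$ is not independent. Consider the following conditions on the pair $(M,R)$ with $r\ge 2$: (i) $P(M,R,1)^r=P(M,R,0)^{r-1}\,P(M,R,r)$; (ii) $P(M,R,a)^2=P(M,R,a+1)\,P(M,R,a-1)$ for all $a\in\{1,\dots,r-1\}$; (iii) $P(M,R,a)^2=P(M,R,a+1)\,P(M,R,a-1)$ for some $a\in\{1,\dots,r-1\}$; (iv) there is a real number $s>0$ such that $|\mathrm{Par}_M(x)\cap R|=s\,|\mathrm{Par}_M(x)\cap(X\setminus R)|$ for all $x\in X$. Then: (1) For every finite loopless matroid $M$ of rank $r\ge 2$ on $X$ and every $R\subseteq X$ with $P(M,R,0)>0$ and $P(M,R,r)>0$, the conditions (i), (ii) and (iv) are equivalent. (2) There exist a finite loopless binary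 matroid $M$ (that is, one representable over $\mathbb F_2$) of rank $r\ge 2$ on a set $X$ and a subset $R\subseteq X$ with $P(M,R,0)>0$ and $P(M,R,r)>0$ such that (iii) holds but (ii) does not. -/

import Mathlib

namespace StanleyYan

/-- The rank of a finite matroid, as a natural number. -/
noncomputable def rk {α : Type*} (M : Matroid α) : ℕ := M.eRank.toNat

/-- The set of bases `A` of `M` with `|A ∩ R| = a`. -/
def basesMeeting {α : Type*} (M : Matroid α) (R : Set α) (a : ℕ) : Set (Set α) :=
  {A | M.IsBase A ∧ (A ∩ R).ncard = a}

/-- `B(M, R, a)`, the number of bases `A` of `M` with `|A ∩ R| = a`. -/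
noncomputable def B {α : Type*} (M : Matroid α) (R : Set α) (a : ℕ) : ℕ :=
  (basesMeeting M R a).ncard

/-- The normalized number of bases `P(M, R, a) = B(M, R, a) / binom(r, a)`, `r = rk M`. -/
noncomputable def P {α : Type*} (M : Matroid α) (R : Set α) (a : ℕ) : ℚ :=
  (B M R a : ℚ) / ((rk M).choose a : ℚ)

/-- The Stanley–Yan inequality is an equality at `a` (used for `a ≥ 1`). -/
def SYEquality {α : Type*} (M : Matroid α) (R : Set α) (a : ℕ) : Prop :=
  P M R a ^ 2 = P M R (a + 1) * P M R (a - 1)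

/-- The parallel class of a non-loop `x`: the element `x` itself, together with all non-loops `y`
such that `{x, y}` is not independent. -/
def Par {α : Type*} (M : Matroid α) (x : α) : Set α :=
  {y | M.IsNonloop y ∧ (y = x ∨ ¬ M.Indep {x, y})}

/-- `φ` represents `M` over the field `𝕜`: a set of elements is independent if and only if the
family of the corresponding vectors (with repetitions) is linearly independent. -/
def IsRepresentation (𝕜 : Type*) [Field 𝕜] {α : Type*} (M : Matroid α) {d : ℕ}
    (φ : α → Fin d → 𝕜) : Prop :=
  ∀ A ⊆ M.E, (M.Indep A ↔ LinearIndepOn 𝕜 φ A)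

/-- A matroid is binary if it has a representation over the field with two elements. -/
def IsBinary {α : Type*} (M : Matroid α) : Prop :=
  ∃ (d : ℕ) (φ : α → Fin d → ZMod 2), IsRepresentation (ZMod 2) M φ

end StanleyYan

/-! Polarize the basis generating polynomial: `mixed M l ∅` sums over ordered free tuples, each slot
weighted by one function from `l`. With a slots weighted by p, the indicator of R, and the other r -
a by q, the indicator of the complement, its value is r! · P(M, R, a) (`mixed_indicator_eq_P`). Part
(1) thus concerns a single symmetric multilinear form.

The inequality behind it is of Alexandrov–Fenchel type (`mixed_mul_mixed_le_sq`), proved by a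
Bochner-type induction on the number of slots: the inequality in the contractions by single elements
forces every positive eigenvalue of a rescaled Hessian to be at least 1, and Perron uniqueness
leaves only one such direction. It makes P log-concave in a, so (i) and (ii) each say that P is a
geometric sequence.

For (iv), put v = p - c • q and u = p + q = 1. Ratio c means that the form vanishes with v in one
slot and any mixture of p and q in the others. By multilinearity v is then isotropic and orthogonal
to u when all remaining slots hold u. As u is strictly positive, equality is rigid
(`classSumsVanish_of_mixed_eq_zero`): v lies in the kernel, the hypotheses pass to contractions, and
when two slots are left they say that v sums to zero on every parallel class. This climbs back to M
through rank-two flats (`ClassSumsVanish.of_insert`), where it is (iv) with s = c. Conversely,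
vanishing class sums kill every value of the form with v in a slot.

For part (2), tripling one point of the Fano plane gives a pair with P = 7, 7, 7, 3. -/

namespace StanleyYan

open Matrix

/-! ### Perron uniqueness and the spectral step of the Bochner method. -/

section LinearAlgebra

variable {ι : Type*} [Fintype ι]

/-- Uniqueness of the Perron vector of a connected nonnegative matrix, in the form of a
generalized eigenvalue problem. -/
theorem perron_unique {H : Matrix ι ι ℝ} (h0 : ∀ i j, 0 ≤ H i j) {u : ι → ℝ}
    (hu : ∀ i, 0 < u i) (hHu : ∀ i, 0 < (H *ᵥ u) i)
    (conn : ∀ S : Set ι, S.Nonempty → (∀ i ∈ S, ∀ j, 0 < H i j → j ∈ S) → ∀ j, j ∈ S)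
    {x : ι → ℝ} {c : ℝ} (hc : 1 ≤ c) (hx : ∀ i, u i * (H *ᵥ x) i = c * (x i * (H *ᵥ u) i)) :
    ∃ m : ℝ, ∀ j, x j = m * u j := by
  have key : ∀ x : ι → ℝ, (∀ i, u i * (H *ᵥ x) i = c * (x i * (H *ᵥ u) i)) →
      (∃ i, 0 < x i) → ∃ m : ℝ, ∀ j, x j = m * u j := by
    intro x hx ⟨i₀, hi₀⟩
    obtain ⟨k, -, hk⟩ := Finset.exists_max_image Finset.univ (fun i => x i / u i)
      ⟨i₀, Finset.mem_univ _⟩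
    set m := x k / u k with hm
    have hle : ∀ j, x j ≤ m * u j := fun j => by
      have := hk j (Finset.mem_univ _)
      rwa [div_le_iff₀ (hu j)] at this
    have hmpos : 0 < m := lt_of_lt_of_le (div_pos hi₀ (hu i₀)) (hk i₀ (Finset.mem_univ _))
    refine ⟨m, conn {j | x j = m * u j} ⟨k, ?_⟩ ?_⟩
    · have := (hu k).ne'
      simp only [Set.mem_ofPred_eq, hm]
      field_simp
    · intro i hi j hij
      simp only [Set.mem_ofPred_eq] at hi ⊢
      have hsum : ∑ l, H i l * (m * u l - x l) = m * (H *ᵥ u) i - (H *ᵥ x) i := by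
        simp only [mulVec, dotProduct, Finset.mul_sum, ← Finset.sum_sub_distrib]
        exact Finset.sum_congr rfl fun l _ => by ring
      have hnn : ∀ l ∈ Finset.univ, 0 ≤ H i l * (m * u l - x l) := fun l _ =>
        mul_nonneg (h0 i l) (sub_nonneg.2 (hle l))
      -- At a maximizer of x / u this sum of nonnegative terms equals (1 - c) * m * (H u) i, which
      -- is nonpositive as c ≥ 1; so the maximizers are closed under adjacency.
      have hz : ∑ l, H i l * (m * u l - x l) = 0 := by
        refine le_antisymm ?_ (Finset.sum_nonneg hnn)
        rw [hsum]
        have h1 := hx i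
        rw [hi] at h1
        have h2 : (H *ᵥ x) i = c * (m * (H *ᵥ u) i) := by
          apply mul_left_cancel₀ (hu i).ne'
          rw [h1]; ring
        rw [h2]
        have := mul_pos hmpos (hHu i)
        nlinarith
      have := (Finset.sum_eq_zero_iff_of_nonneg hnn).1 hz j (Finset.mem_univ _)
      rcases mul_eq_zero.1 this with h | h
      · exact absurd h hij.ne'
      · linarith
  by_cases hpos : ∃ i, 0 < x i
  · exact key x hx hpos
  by_cases hneg : ∃ i, x i < 0
  · obtain ⟨i, hi⟩ := hneg
    obtain ⟨m, hm⟩ := key (-x) (fun i => by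
      have := hx i
      simp only [mulVec_neg, Pi.neg_apply]
      linarith) ⟨i, by simpa using hi⟩
    refine ⟨-m, fun j => ?_⟩
    have := hm j
    simp only [Pi.neg_apply] at this
    linarith
  · push Not at hpos hneg
    exact ⟨0, fun j => by rw [zero_mul]; exact le_antisymm (hpos j) (hneg j)⟩

/-- A connected nonnegative symmetric matrix `H` with
`⟨v, H v⟩ ≤ ∑ i, u i * (H v) i ^ 2 / (H u) i` for a positive vector `u` is negative semidefinite on
the hyperplane `⟨u, H v⟩ = 0`. -/
theorem dotProduct_mulVec_nonpos_of_le {H : Matrix ι ι ℝ} (hs : H.IsSymm)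
    (h0 : ∀ i j, 0 ≤ H i j) {u : ι → ℝ}
    (hu : ∀ i, 0 < u i) (hHu : ∀ i, 0 < (H *ᵥ u) i)
    (conn : ∀ S : Set ι, S.Nonempty → (∀ i ∈ S, ∀ j, 0 < H i j → j ∈ S) → ∀ j, j ∈ S)
    (hq : ∀ v, v ⬝ᵥ H *ᵥ v ≤ ∑ i, u i * (H *ᵥ v) i ^ 2 / (H *ᵥ u) i)
    {v : ι → ℝ} (hv : u ⬝ᵥ H *ᵥ v = 0) : v ⬝ᵥ H *ᵥ v ≤ 0 := by
  classical
  -- Conjugating H by s turns `hq` into ⟨y, A y⟩ ≤ ‖A y‖², so each eigenvalue satisfies c ≤ c²: it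
  -- is nonpositive or at least 1.
  set s : ι → ℝ := fun i => √(u i / (H *ᵥ u) i) with hsdef
  have hspos : ∀ i, 0 < s i := fun i => Real.sqrt_pos.2 (div_pos (hu i) (hHu i))
  have hsq : ∀ i, s i ^ 2 = u i / (H *ᵥ u) i := fun i =>
    Real.sq_sqrt (div_pos (hu i) (hHu i)).le
  set A : Matrix ι ι ℝ := Matrix.of fun i j => s i * H i j * s j with hAdef
  have hA : A.IsHermitian := by
    ext i j
    simp only [conjTranspose_apply, star_trivial, hAdef, of_apply]
    rw [hs.apply i j]; ring
  have hAv : ∀ (y : ι → ℝ) i, (A *ᵥ y) i = s i * (H *ᵥ (fun j => s j * y j)) i := by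
    intro y i
    simp only [mulVec, dotProduct, hAdef, of_apply, Finset.mul_sum]
    exact Finset.sum_congr rfl fun j _ => by ring
  have hquad : ∀ y z : ι → ℝ,
      z ⬝ᵥ A *ᵥ y = (fun j => s j * z j) ⬝ᵥ H *ᵥ (fun j => s j * y j) := by
    intro y z
    simp only [dotProduct, hAv]
    exact Finset.sum_congr rfl fun j _ => by ring
  set b := hA.eigenvectorBasis with hb
  set y : ι → ℝ := fun i => v i / s i with hy
  have hsy : (fun j => s j * y j) = v := by
    funext j
    have := (hspos j).ne'
    simp only [hy]; field_simp
  have hnorm : ∀ k, (b k).ofLp ⬝ᵥ (b k).ofLp = 1 := by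
    intro k
    have h := b.orthonormal.1 k
    have h2 : inner ℝ (b k) (b k) = (1 : ℝ) := by
      rw [real_inner_self_eq_norm_sq, h]; norm_num
    rw [EuclideanSpace.inner_eq_star_dotProduct] at h2
    simpa using h2
  have hexp : v ⬝ᵥ H *ᵥ v = ∑ k, hA.eigenvalues k * ((b k).ofLp ⬝ᵥ y) ^ 2 := by
    have h1 : v ⬝ᵥ H *ᵥ v = y ⬝ᵥ A *ᵥ y := by rw [hquad, hsy]
    have h2 := b.sum_inner_mul_inner (WithLp.toLp 2 y) (WithLp.toLp 2 (A *ᵥ y))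
    simp only [EuclideanSpace.inner_eq_star_dotProduct, star_trivial] at h2
    rw [h1, dotProduct_comm, ← h2]
    refine Finset.sum_congr rfl fun k _ => ?_
    have h3 : (A *ᵥ y) ⬝ᵥ (b k).ofLp = hA.eigenvalues k * ((b k).ofLp ⬝ᵥ y) := by
      have h4 : (A *ᵥ y) ⬝ᵥ (b k).ofLp = y ⬝ᵥ (A *ᵥ (b k).ofLp) := by
        rw [dotProduct_comm, dotProduct_mulVec, dotProduct_comm, ← mulVec_transpose]
        congr 2
      rw [h4, hb, hA.mulVec_eigenvectorBasis k, dotProduct_smul, smul_eq_mul, dotProduct_comm]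
    rw [h3]; ring
  rw [hexp]
  refine Finset.sum_nonpos fun k _ => ?_
  rcases le_or_gt (hA.eigenvalues k) 0 with hk | hk
  · exact mul_nonpos_of_nonpos_of_nonneg hk (sq_nonneg _)
  set c := hA.eigenvalues k with hc
  have heig : ∀ i, s i * (H *ᵥ (fun j => s j * (b k).ofLp j)) i = c * (b k).ofLp i := by
    intro i
    rw [← hAv, hb, hA.mulVec_eigenvectorBasis k]; rfl
  have hcle : c ≤ c ^ 2 := by
    have h1 := hq (fun j => s j * (b k).ofLp j)
    rw [← hquad, hb, hA.mulVec_eigenvectorBasis k, dotProduct_smul, smul_eq_mul, ← hb, hnorm,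
      mul_one] at h1
    refine h1.trans (le_of_eq ?_)
    rw [← mul_one (c ^ 2), ← hnorm k, dotProduct, Finset.mul_sum]
    refine Finset.sum_congr rfl fun i _ => ?_
    have h2 : (H *ᵥ (fun j => s j * (b k).ofLp j)) i = c * (b k).ofLp i / s i := by
      rw [← heig i, mul_div_cancel_left₀ _ (hspos i).ne']
    rw [h2, div_pow, hsq]
    have := (hu i).ne'
    have := (hHu i).ne'
    field_simp
  have hc1 : 1 ≤ c := by nlinarith
  obtain ⟨m, hm⟩ := perron_unique h0 hu hHu conn (x := fun j => s j * (b k).ofLp j) hc1 (by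
    intro i
    have h1 := heig i
    have h2 : u i = s i ^ 2 * (H *ᵥ u) i := by rw [hsq, div_mul_cancel₀ _ (hHu i).ne']
    calc u i * (H *ᵥ fun j => s j * (b k).ofLp j) i
        = s i * (H *ᵥ u) i * (s i * (H *ᵥ fun j => s j * (b k).ofLp j) i) := by
          conv_lhs => rw [h2]
          ring
      _ = _ := by rw [h1]; ring)
  -- An eigenvector with c ≥ 1 is a multiple of u / s, and orthogonality of u / s to y = v / s is
  -- exactly `hv`.
  have hzero : (b k).ofLp ⬝ᵥ y = 0 := by
    have h1 : (b k).ofLp ⬝ᵥ y = m * ((H *ᵥ u) ⬝ᵥ v) := by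
      rw [dotProduct, dotProduct, Finset.mul_sum]
      refine Finset.sum_congr rfl fun i _ => ?_
      have h2 : (b k).ofLp i = m * u i / s i := by
        rw [← hm i, mul_div_cancel_left₀ _ (hspos i).ne']
      have h3 : u i = s i ^ 2 * (H *ᵥ u) i := by rw [hsq, div_mul_cancel₀ _ (hHu i).ne']
      rw [h2, hy, h3]
      have := (hspos i).ne'
      field_simp
    rw [h1, dotProduct_comm, ← hs.eq, mulVec_transpose, dotProduct_comm, ← dotProduct_mulVec, hv,
      mul_zero]
  rw [hzero]; simp

end LinearAlgebra

/-! ### Forms with at most one positive direction. -/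

section BilinForm

variable {W : Type*} [AddCommGroup W] [Module ℝ W]

/-- Reverse Cauchy–Schwarz for a symmetric form that is negative semidefinite on a hyperplane. -/
theorem mul_le_sq_of_nonpos_on_hyperplane (B : LinearMap.BilinForm ℝ W)
    (hB : ∀ x y, B x y = B y x) (φ : W → ℝ) (hφ : ∀ x y (c : ℝ), φ (x - c • y) = φ x - c * φ y)
    (h : ∀ x, φ x = 0 → B x x ≤ 0) {w : W} (hw : 0 < B w w) (v : W) :
    B v v * B w w ≤ B v w ^ 2 := by
  have hne : φ w ≠ 0 := fun h0 => absurd (h w h0) (not_le.2 hw)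
  have hx := h (v - (φ v / φ w) • w) (by rw [hφ]; field_simp; ring)
  set c := φ v / φ w
  simp only [map_sub, map_smul, LinearMap.sub_apply, LinearMap.smul_apply, smul_eq_mul,
    hB w v] at hx
  nlinarith [sq_nonneg (c * B w w - B v w), mul_le_mul_of_nonneg_right hx hw.le]

/-- An isotropic vector orthogonal to a positive vector of a Lorentzian form lies in its kernel. -/
theorem eq_zero_of_isotropic (B : LinearMap.BilinForm ℝ W)
    (hB : ∀ x y, B x y = B y x) {u : W} (hu : 0 < B u u)
    (h : ∀ x, B x x * B u u ≤ B x u ^ 2) {v : W} (hvu : B v u = 0) (hvv : B v v = 0) (z : W) :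
    B z v = 0 := by
  have hneg : ∀ x, B x u = 0 → B x x ≤ 0 := by
    intro x hx
    have := h x
    rw [hx] at this
    nlinarith
  set y := z - (B z u / B u u) • u with hy
  have hyu : B y u = 0 := by
    simp only [hy, map_sub, map_smul, LinearMap.sub_apply, LinearMap.smul_apply, smul_eq_mul]
    field_simp; ring
  have hyv : B y v = B z v := by
    simp only [hy, map_sub, map_smul, LinearMap.sub_apply, LinearMap.smul_apply, smul_eq_mul,
      hB u v, hvu]
    ring
  have hyy := hneg y hyu
  -- On this vector the form equals (B y v)² * (2 - B y y), and B y y ≤ 0, so nonpositivity forces B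
  -- y v = 0.
  have hxx := hneg ((1 - B y y) • v + B y v • y) (by
    simp only [map_add, map_smul, LinearMap.add_apply, LinearMap.smul_apply, smul_eq_mul, hyu,
      hvu]
    ring)
  simp only [map_add, map_smul, LinearMap.add_apply, LinearMap.smul_apply, smul_eq_mul, hvv,
    hB v y] at hxx
  rw [← hyv]
  nlinarith [sq_nonneg (B y v)]

end BilinForm

/-! ### The polarized basis generating polynomial. -/

section Mixed

variable {α : Type*} {M : Matroid α}

theorem notMem_closure_insert_of_notMem {I : Set α} {e f : α}
    (heI : e ∉ M.closure I) (hf : f ∉ M.closure (insert e I)) : e ∉ M.closure (insert f I) :=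
  fun h => hf (M.closure_exchange ⟨h, heI⟩).1

theorem closure_subset_closure_insert (I : Set α) (e : α) :
    M.closure I ⊆ M.closure (insert e I) :=
  M.closure_subset_closure (Set.subset_insert _ _)

theorem ncard_eq_rk {A : Set α} (hA : M.IsBase A) : A.ncard = rk M := by
  rw [rk, ← hA.encard_eq_eRank]; rfl

/-- Nonnegative weights whose support is spanning. -/
def IsSpanningWeight (M : Matroid α) (v : α → ℝ) : Prop :=
  (∀ e ∈ M.E, 0 ≤ v e) ∧ ∃ A, M.IsBase A ∧ ∀ e ∈ A, 0 < v e

theorem isSpanningWeight_of_pos {v : α → ℝ} (hv : ∀ e ∈ M.E, 0 < v e) : IsSpanningWeight M v := by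
  obtain ⟨A, hA⟩ := M.exists_isBase
  exact ⟨fun e he => (hv e he).le, A, hA, fun e he => hv e (hA.subset_ground he)⟩

variable (M) [M.Finite]

open Classical in
/-- The elements of `M` outside the closure of `I`. -/
noncomputable def offClosure (I : Set α) : Finset α :=
  {e ∈ M.ground_finite.toFinset | e ∉ M.closure I}

/-- The weighted number of tuples `(e₁, …, eₖ)` extending `I` freely, where `eᵢ` is weighted by the
`i`-th function of the list: the polarized basis generating polynomial of the contraction by `I`. -/
noncomputable def mixed : List (α → ℝ) → Set α → ℝ
  | [], _ => 1
  | v :: l, I => ∑ e ∈ offClosure M I, v e * mixed l (insert e I)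

variable {M}

theorem mem_offClosure {I : Set α} {e : α} :
    e ∈ offClosure M I ↔ e ∈ M.E ∧ e ∉ M.closure I := by
  simp [offClosure]

theorem mixed_nil (I : Set α) : mixed M [] I = 1 := rfl

theorem mixed_cons (v : α → ℝ) (l : List (α → ℝ)) (I : Set α) :
    mixed M (v :: l) I = ∑ e ∈ offClosure M I, v e * mixed M l (insert e I) := rfl

theorem offClosure_congr {I J : Set α} (h : M.closure I = M.closure J) :
    offClosure M I = offClosure M J := by
  ext e
  simp only [mem_offClosure, h]

theorem mixed_congr_closure (l : List (α → ℝ)) {I J : Set α} (h : M.closure I = M.closure J) :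
    mixed M l I = mixed M l J := by
  induction l generalizing I J with
  | nil => rfl
  | cons v l ih =>
    rw [mixed_cons, mixed_cons, offClosure_congr h]
    exact Finset.sum_congr rfl fun e _ => by rw [ih (M.closure_insert_congr_right h)]

/-- The exchange property makes ordered free pairs symmetric; this is what allows two slots of
`mixed` to be swapped. -/
theorem offClosure_pair_comm {I : Set α} {e f : α} :
    (e ∈ offClosure M I ∧ f ∈ offClosure M (insert e I)) ↔
      (e ∈ offClosure M (insert f I) ∧ f ∈ offClosure M I) := by
  simp only [mem_offClosure]
  constructor
  · rintro ⟨⟨he, heI⟩, hf, hfI⟩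
    exact ⟨⟨he, notMem_closure_insert_of_notMem heI hfI⟩, hf,
      fun h => hfI (closure_subset_closure_insert I e h)⟩
  · rintro ⟨⟨he, heI⟩, hf, hfI⟩
    exact ⟨⟨he, fun h => heI (closure_subset_closure_insert I f h)⟩, hf,
      notMem_closure_insert_of_notMem hfI heI⟩

theorem mixed_swap (v w : α → ℝ) (l : List (α → ℝ)) (I : Set α) :
    mixed M (v :: w :: l) I = mixed M (w :: v :: l) I := by
  simp only [mixed_cons, Finset.mul_sum]
  rw [Finset.sum_comm' (t' := offClosure M I) (s' := fun f => offClosure M (insert f I))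
    (fun e f => offClosure_pair_comm)]
  refine Finset.sum_congr rfl fun e _ => Finset.sum_congr rfl fun f _ => ?_
  rw [Set.insert_comm]; ring

theorem mixed_perm {l l' : List (α → ℝ)} (h : l.Perm l') (I : Set α) :
    mixed M l I = mixed M l' I := by
  induction h generalizing I with
  | nil => rfl
  | cons v _ ih => simp only [mixed_cons, ih]
  | swap v w l => exact mixed_swap _ _ _ _
  | trans _ _ ih₁ ih₂ => rw [ih₁, ih₂]

theorem mixed_add (v w : α → ℝ) (l : List (α → ℝ)) (I : Set α) :
    mixed M ((v + w) :: l) I = mixed M (v :: l) I + mixed M (w :: l) I := by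
  simp only [mixed_cons, Pi.add_apply, add_mul, Finset.sum_add_distrib]

theorem mixed_smul (c : ℝ) (v : α → ℝ) (l : List (α → ℝ)) (I : Set α) :
    mixed M ((c • v) :: l) I = c * mixed M (v :: l) I := by
  simp only [mixed_cons, Pi.smul_apply, smul_eq_mul, Finset.mul_sum, mul_assoc]

variable (M) in
/-- The quadratic form of `mixed` in its first two arguments. -/
noncomputable def mixedForm (l : List (α → ℝ)) (I : Set α) : LinearMap.BilinForm ℝ (α → ℝ) :=
  LinearMap.mk₂ ℝ (fun v w => mixed M (v :: w :: l) I)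
    (fun _ _ _ => mixed_add _ _ _ _) (fun _ _ _ => mixed_smul _ _ _ _)
    (fun v w w' => by simp only [mixed_swap v, mixed_add])
    (fun c v w => by simp only [mixed_swap v, mixed_smul, smul_eq_mul])

theorem mixedForm_apply (l : List (α → ℝ)) (I : Set α) (v w : α → ℝ) :
    mixedForm M l I v w = mixed M (v :: w :: l) I := rfl

theorem mixedForm_comm (l : List (α → ℝ)) (I : Set α) (v w : α → ℝ) :
    mixedForm M l I v w = mixedForm M l I w v := mixed_swap _ _ _ _

theorem insert_indep_of_mem_offClosure {I : Set α} (hI : M.Indep I) {e : α}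
    (he : e ∈ offClosure M I) : M.Indep (insert e I) ∧ (insert e I).ncard = I.ncard + 1 := by
  rw [mem_offClosure] at he
  have h := (hI.notMem_closure_iff he.1).1 he.2
  exact ⟨h.1, Set.ncard_insert_of_notMem h.2 (M.ground_finite.subset hI.subset_ground)⟩

theorem mixed_nonneg {l : List (α → ℝ)} (hl : ∀ v ∈ l, ∀ e ∈ M.E, 0 ≤ v e) (I : Set α) :
    0 ≤ mixed M l I := by
  induction l generalizing I with
  | nil => exact zero_le_one
  | cons v l ih =>
    refine Finset.sum_nonneg fun e he => mul_nonneg ?_ ?_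
    · exact hl v (by simp) e (mem_offClosure.1 he).1
    · exact ih (fun w hw => hl w (List.mem_cons_of_mem _ hw)) _

theorem exists_mem_offClosure {I : Set α} (hI : M.Indep I) (hr : I.ncard < rk M) {A : Set α}
    (hA : M.IsBase A) : ∃ e ∈ A, e ∈ offClosure M I := by
  obtain ⟨e, he, hi⟩ := hI.exists_insert_of_not_isBase
    (fun h => hr.ne (ncard_eq_rk h)) hA
  have heE := hA.subset_ground he.1
  exact ⟨e, he.1, mem_offClosure.2 ⟨heE, (hI.notMem_closure_iff heE).2 ⟨hi, he.2⟩⟩⟩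

/-- A basis inside the support of the next weight always supplies an element augmenting I, so one
term stays positive until the list is exhausted. -/
theorem mixed_pos {l : List (α → ℝ)} (hl : ∀ v ∈ l, IsSpanningWeight M v) {I : Set α}
    (hI : M.Indep I) (hr : I.ncard + l.length ≤ rk M) : 0 < mixed M l I := by
  induction l generalizing I with
  | nil => exact zero_lt_one
  | cons v l ih =>
    obtain ⟨hv, A, hA, hpos⟩ := hl v (by simp)
    have hl' : ∀ w ∈ l, IsSpanningWeight M w := fun w hw => hl w (List.mem_cons_of_mem _ hw)
    rw [List.length_cons] at hr
    obtain ⟨e, heA, he⟩ := exists_mem_offClosure hI (by omega) hA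
    refine Finset.sum_pos' (fun f hf => mul_nonneg (hv f (mem_offClosure.1 hf).1)
      (mixed_nonneg (fun w hw => (hl' w hw).1) _)) ⟨e, he, mul_pos (hpos e heA) ?_⟩
    obtain ⟨h1, h2⟩ := insert_indep_of_mem_offClosure hI he
    exact ih hl' h1 (by omega)

end Mixed

/-! ### The Alexandrov–Fenchel inequality for matroids. -/

section AlexandrovFenchel

variable {α : Type*} {M : Matroid α}

theorem mem_closure_insert_iff_closure_eq {I : Set α} {e f : α}
    (hf : f ∈ M.E) (hfI : f ∉ M.closure I) (hI : I ⊆ M.E) :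
    f ∈ M.closure (insert e I) ↔ M.closure (insert f I) = M.closure (insert e I) := by
  constructor
  · intro h
    exact M.closure_insert_congr ⟨h, hfI⟩
  · intro h
    rw [← h]
    exact M.mem_closure_of_mem (Set.mem_insert _ _) (Set.insert_subset hf hI)

variable [M.Finite]

open Classical in
theorem offClosure_insert (I : Set α) (e : α) :
    offClosure M (insert e I) = {f ∈ offClosure M I | f ∉ M.closure (insert e I)} := by
  ext f
  simp only [mem_offClosure, Finset.mem_filter]
  exact ⟨fun h => ⟨⟨h.1, fun h' => h.2 (closure_subset_closure_insert I e h')⟩, h.2⟩,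
    fun h => ⟨h.1.1, h.2⟩⟩

open Classical in
-- Passing from I to `insert e I` removes precisely the parallel class of e in the contraction by I,
-- classes being encoded by closures.
theorem sum_offClosure_insert {I : Set α} (hI : I ⊆ M.E) (e : α) (g : α → ℝ) :
    ∑ f ∈ offClosure M (insert e I), g f = ∑ f ∈ offClosure M I, g f -
      ∑ f ∈ offClosure M I with M.closure (insert f I) = M.closure (insert e I), g f := by
  rw [eq_sub_iff_add_eq, offClosure_insert, add_comm,
    ← Finset.sum_filter_add_sum_filter_not (offClosure M I)
      (fun f => M.closure (insert f I) = M.closure (insert e I))]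
  congr 1
  refine Finset.sum_congr (Finset.filter_congr fun f hf => ?_) fun _ _ => rfl
  rw [mem_offClosure] at hf
  rw [mem_closure_insert_iff_closure_eq hf.1 hf.2 hI]

/-- With two slots the form is (∑ x)² minus the sum of the squared class sums. This is the base case
of the induction. -/
theorem mixed_pair_nonpos {I : Set α} (hI : I ⊆ M.E) {x : α → ℝ}
    (hx : ∑ e ∈ offClosure M I, x e = 0) : mixed M [x, x] I ≤ 0 := by
  classical
  set κ : α → Set α := fun e => M.closure (insert e I) with hκ
  set a : Set α → ℝ := fun c => ∑ f ∈ offClosure M I with κ f = c, x f with ha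
  have h1 : mixed M [x, x] I = ∑ e ∈ offClosure M I, -(x e * a (κ e)) := by
    rw [mixed_cons]
    refine Finset.sum_congr rfl fun e _ => ?_
    simp only [mixed_cons, mixed_nil, mul_one]
    rw [sum_offClosure_insert hI, hx, zero_sub, mul_neg]
  rw [h1, Finset.sum_neg_distrib, neg_nonpos,
    ← Finset.sum_fiberwise_of_maps_to (t := (offClosure M I).image κ) (g := κ)
      (fun e he => Finset.mem_image_of_mem _ he)]
  refine Finset.sum_nonneg fun c _ => ?_
  have h2 : ∑ e ∈ offClosure M I with κ e = c, x e * a (κ e) = a c * a c := by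
    rw [ha, Finset.sum_mul]
    refine Finset.sum_congr rfl fun e he => ?_
    rw [(Finset.mem_filter.1 he).2]
  rw [h2]
  exact mul_self_nonneg _

open Classical in
variable (M) in
/-- The coefficients of `mixedForm M l I`. -/
noncomputable def hess (l : List (α → ℝ)) (I : Set α) (e f : α) : ℝ :=
  if f ∈ M.closure (insert e I) then 0 else mixed M l (insert f (insert e I))

theorem sum_hess_mul (l : List (α → ℝ)) (I : Set α) (e : α) (x : α → ℝ) :
    ∑ f ∈ offClosure M I, hess M l I e f * x f = mixed M (x :: l) (insert e I) := by
  classical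
  rw [mixed_cons, offClosure_insert, Finset.sum_filter]
  refine Finset.sum_congr rfl fun f _ => ?_
  unfold hess
  by_cases h : f ∈ M.closure (insert e I) <;> simp [h, mul_comm]

theorem hess_comm (l : List (α → ℝ)) (I : Set α) {e f : α} (he : e ∈ offClosure M I)
    (hf : f ∈ offClosure M I) : hess M l I e f = hess M l I f e := by
  rw [mem_offClosure] at he hf
  unfold hess
  rw [Set.insert_comm]
  by_cases h : f ∈ M.closure (insert e I)
  · rw [if_pos h, if_pos (M.closure_exchange ⟨h, hf.2⟩).1]
  · rw [if_neg h, if_neg (notMem_closure_insert_of_notMem he.2 h)]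

theorem hess_nonneg {l : List (α → ℝ)} (hl : ∀ v ∈ l, ∀ e ∈ M.E, 0 ≤ v e) (I : Set α) (e f : α) :
    0 ≤ hess M l I e f := by
  unfold hess
  split_ifs
  · exact le_rfl
  · exact mixed_nonneg hl _

theorem hess_pos {l : List (α → ℝ)} (hl : ∀ v ∈ l, IsSpanningWeight M v) {I : Set α}
    (hI : M.Indep I) (hr : I.ncard + l.length + 2 ≤ rk M) {e f : α} (he : e ∈ offClosure M I)
    (hf : f ∈ offClosure M (insert e I)) : 0 < hess M l I e f := by
  unfold hess
  rw [if_neg (mem_offClosure.1 hf).2]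
  obtain ⟨h1, h2⟩ := insert_indep_of_mem_offClosure hI he
  obtain ⟨h3, h4⟩ := insert_indep_of_mem_offClosure h1 hf
  exact mixed_pos hl h3 (by omega)

/-- Non-parallel elements are adjacent, and two parallel ones share a neighbour, namely any element
outside the closure they span with I. -/
theorem hess_connected {l : List (α → ℝ)} (hl : ∀ v ∈ l, IsSpanningWeight M v) {I : Set α}
    (hI : M.Indep I) (hr : I.ncard + l.length + 2 ≤ rk M) (S : Set (offClosure M I))
    (hS : S.Nonempty) (hcl : ∀ i ∈ S, ∀ j : offClosure M I, 0 < hess M l I i j → j ∈ S)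
    (j : offClosure M I) : j ∈ S := by
  classical
  obtain ⟨i, hi⟩ := hS
  by_cases hij : (j : α) ∈ M.closure (insert (i : α) I)
  · obtain ⟨h1, h2⟩ := insert_indep_of_mem_offClosure hI i.2
    obtain ⟨A, hA⟩ := M.exists_isBase
    obtain ⟨k, -, hk⟩ := exists_mem_offClosure h1 (by omega) hA
    have hkI : k ∈ offClosure M I := by
      rw [offClosure_insert, Finset.mem_filter] at hk
      exact hk.1
    have hkS : (⟨k, hkI⟩ : offClosure M I) ∈ S := hcl i hi _ (hess_pos hl hI hr i.2 hk)
    refine hcl _ hkS j (hess_pos hl hI hr hkI ?_)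
    have hjE := (mem_offClosure.1 j.2)
    refine (offClosure_pair_comm.1 ⟨j.2, mem_offClosure.2 ⟨(mem_offClosure.1 hk).1, ?_⟩⟩).1
    rw [(mem_closure_insert_iff_closure_eq hjE.1 hjE.2 hI.subset_ground).1 hij]
    exact (mem_offClosure.1 hk).2
  · exact hcl i hi j (hess_pos hl hI hr i.2 (mem_offClosure.2 ⟨(mem_offClosure.1 j.2).1, hij⟩))

/-- The Alexandrov–Fenchel inequality for the basis generating polynomial of a matroid. -/
theorem mixed_mul_mixed_le_sq {l : List (α → ℝ)} (hl : ∀ w ∈ l, ∀ e ∈ M.E, 0 < w e) {I : Set α}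
    (hI : M.Indep I) (hr : I.ncard + l.length + 2 ≤ rk M) {u : α → ℝ} (hu : ∀ e ∈ M.E, 0 < u e)
    (v : α → ℝ) :
    mixed M (v :: v :: l) I * mixed M (u :: u :: l) I ≤ mixed M (v :: u :: l) I ^ 2 := by
  induction l generalizing I u v with
  | nil =>
    refine mul_le_sq_of_nonpos_on_hyperplane (mixedForm M [] I) (mixedForm_comm _ _)
      (fun x => ∑ e ∈ offClosure M I, x e) (fun x y c => ?_)
      (fun x hx => mixed_pair_nonpos hI.subset_ground hx) (w := u) ?_ v
    · simp [Finset.sum_sub_distrib, Finset.mul_sum]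
    · refine mixed_pos (fun w hw => ?_) hI (by simpa using hr)
      obtain rfl : w = u := by simpa using hw
      exact isSpanningWeight_of_pos hu
  | cons t l ih =>
    have ht : ∀ e ∈ M.E, 0 < t e := hl t (by simp)
    have hl' : ∀ w ∈ l, ∀ e ∈ M.E, 0 < w e := fun w hw => hl w (List.mem_cons_of_mem _ hw)
    have hsp : ∀ w ∈ t :: l, IsSpanningWeight M w := fun w hw => isSpanningWeight_of_pos (hl w hw)
    rw [List.length_cons] at hr
    have hpos : ∀ w : α → ℝ, (∀ e ∈ M.E, 0 < w e) → ∀ w' : α → ℝ, (∀ e ∈ M.E, 0 < w' e) →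
        ∀ s ∈ w :: w' :: t :: l, IsSpanningWeight M s := by
      intro w hw w' hw' s hs
      rcases List.mem_cons.1 hs with rfl | hs
      · exact isSpanningWeight_of_pos hw
      rcases List.mem_cons.1 hs with rfl | hs
      · exact isSpanningWeight_of_pos hw'
      · exact hsp s hs
    refine mul_le_sq_of_nonpos_on_hyperplane (mixedForm M (t :: l) I) (mixedForm_comm _ _)
      (mixedForm M (t :: l) I t) (fun x y c => by simp) (fun x hx => ?_) (w := u)
      (mixed_pos (hpos u hu u hu) hI (by simp; omega)) v
    set H : Matrix (offClosure M I) (offClosure M I) ℝ :=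
      Matrix.of fun i j => hess M (t :: l) I i j with hH
    have hHv : ∀ (y : α → ℝ) (i : offClosure M I),
        (H *ᵥ fun j => y j) i = mixed M (y :: t :: l) (insert (i : α) I) := by
      intro y i
      rw [← sum_hess_mul, ← Finset.sum_coe_sort]
      rfl
    have hquad : ∀ y z : α → ℝ, (fun j : offClosure M I => y j) ⬝ᵥ (H *ᵥ fun j => z j) =
        mixed M (y :: z :: t :: l) I := by
      intro y z
      rw [mixed_cons, ← Finset.sum_coe_sort]
      simp only [dotProduct, hHv]
    have hstep : ∀ i : offClosure M I, M.Indep (insert (i : α) I) ∧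
        (insert (i : α) I).ncard = I.ncard + 1 := fun i => insert_indep_of_mem_offClosure hI i.2
    have hHt : ∀ i : offClosure M I, 0 < mixed M (t :: t :: l) (insert (i : α) I) := fun i =>
      mixed_pos (fun s hs => hpos t ht t ht s (by simp at hs ⊢; tauto)) (hstep i).1
        (by rw [(hstep i).2]; simp; omega)
    -- The list entry t serves as the Perron vector: expanding ⟨y, H y⟩ along the slot of t reduces
    -- the quadratic hypothesis to the induction hypothesis in each contraction by i.
    have hmain := dotProduct_mulVec_nonpos_of_le (H := H) (u := fun i => t i)
      (Matrix.IsSymm.ext fun i j => hess_comm _ _ j.2 i.2)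
      (fun i j => hess_nonneg (fun w hw => (hsp w hw).1) _ _ _)
      (fun i => ht i (mem_offClosure.1 i.2).1)
      (fun i => by rw [hHv]; exact hHt i)
      (fun S hS hcl j => hess_connected hsp hI (by simp; omega) S hS hcl j)
      (fun y => ?_) (v := fun i => x i) (by rw [hquad]; exact hx)
    · rw [hquad] at hmain
      exact hmain
    · classical
      obtain ⟨y', rfl⟩ : ∃ y' : α → ℝ, y = fun j : offClosure M I => y' j :=
        ⟨fun e => if h : e ∈ offClosure M I then y ⟨e, h⟩ else 0, by funext j; simp⟩
      have hperm : mixed M (y' :: y' :: t :: l) I = mixed M (t :: y' :: y' :: l) I :=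
        mixed_perm (List.perm_middle (l₁ := [y', y'])) I
      rw [hquad, hperm, mixed_cons, ← Finset.sum_coe_sort]
      refine Finset.sum_le_sum fun i _ => ?_
      rw [hHv, hHv, mul_div_assoc]
      refine mul_le_mul_of_nonneg_left ?_ (ht i (mem_offClosure.1 i.2).1).le
      rw [le_div_iff₀ (hHt i)]
      exact ih hl' (hstep i).1 (by rw [(hstep i).2]; omega) ht y'

end AlexandrovFenchel

/-! ### Rigidity in the equality case. -/

section ClassSums

/-- If n ≥ 2 fibers each sum to the total T, then T = n * T. -/
theorem sum_eq_zero_of_fiber_sums_eq {α β : Type*} [DecidableEq β] {S : Finset α} {κ : α → β}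
    {v : α → ℝ} (h : ∀ e ∈ S, ∑ f ∈ S with κ f = κ e, v f = ∑ f ∈ S, v f) {e f : α} (he : e ∈ S)
    (hf : f ∈ S) (hef : κ e ≠ κ f) : ∑ f ∈ S, v f = 0 := by
  have h1 : ∑ f ∈ S, v f = (S.image κ).card * ∑ f ∈ S, v f := by
    conv_lhs => rw [← Finset.sum_fiberwise_of_maps_to (t := S.image κ) (g := κ)
      (fun e he => Finset.mem_image_of_mem _ he)]
    rw [← nsmul_eq_mul]
    refine Finset.sum_eq_card_nsmul fun c hc => ?_
    obtain ⟨g, hg, rfl⟩ := Finset.mem_image.1 hc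
    exact h g hg
  have h2 : 1 < (S.image κ).card := Finset.one_lt_card.2
    ⟨κ e, Finset.mem_image_of_mem _ he, κ f, Finset.mem_image_of_mem _ hf, hef⟩
  have h3 : (1 : ℝ) < (S.image κ).card := by exact_mod_cast h2
  have h4 : (((S.image κ).card : ℝ) - 1) * ∑ f ∈ S, v f = 0 := by linarith
  exact (mul_eq_zero.1 h4).resolve_left (by linarith)

variable {α : Type*} {M : Matroid α}

theorem closure_insert_insert_eq {I : Set α} {e g e' f : α}
    (he' : e' ∈ M.closure (insert g (insert e I))) (he'I : e' ∉ M.closure I)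
    (hf : f ∈ M.closure (insert g (insert e I))) (hfI : f ∉ M.closure (insert e' I)) :
    M.closure (insert f (insert e' I)) = M.closure (insert g (insert e I)) := by
  by_cases h : e' ∈ M.closure (insert e I)
  · have h1 := M.closure_insert_congr ⟨h, he'I⟩
    rw [M.closure_insert_congr_right (e := f) h1]
    exact M.closure_insert_congr ⟨hf, by rwa [← h1]⟩
  · have h1 := M.closure_insert_congr ⟨he', h⟩
    rw [← h1, Set.insert_comm e' e]
    exact M.closure_insert_congr ⟨by rwa [Set.insert_comm, h1], hfI⟩

variable [M.Finite]

open Classical in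
/-- The weights `v` sum to zero over each parallel class of the contraction by `I`. -/
def ClassSumsVanish (M : Matroid α) [M.Finite] (v : α → ℝ) (I : Set α) : Prop :=
  ∀ e ∈ offClosure M I,
    ∑ f ∈ offClosure M I with M.closure (insert f I) = M.closure (insert e I), v f = 0

theorem exists_mem_offClosure_insert {I : Set α} (hI : M.Indep I) (hr : I.ncard + 2 ≤ rk M) {e : α}
    (he : e ∈ offClosure M I) : ∃ g, g ∈ offClosure M (insert e I) := by
  obtain ⟨h1, h2⟩ := insert_indep_of_mem_offClosure hI he
  obtain ⟨A, hA⟩ := M.exists_isBase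
  obtain ⟨g, -, hg⟩ := exists_mem_offClosure h1 (by omega) hA
  exact ⟨g, hg⟩

theorem closure_ne_of_mem_offClosure_insert {I : Set α} (hI : I ⊆ M.E) {e g : α}
    (hg : g ∈ offClosure M (insert e I)) : M.closure (insert e I) ≠ M.closure (insert g I) := by
  rw [mem_offClosure] at hg
  intro h
  apply hg.2
  rw [h]
  exact M.mem_closure_of_mem (Set.mem_insert _ _) (Set.insert_subset hg.1 hI)

theorem mem_offClosure_of_insert {I : Set α} {e g : α} (hg : g ∈ offClosure M (insert e I)) :
    g ∈ offClosure M I := by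
  classical
  rw [offClosure_insert, Finset.mem_filter] at hg
  exact hg.1

theorem ClassSumsVanish.of_sum_eq_zero {v : α → ℝ} {I : Set α} (hI : M.Indep I)
    (hr : I.ncard + 2 ≤ rk M)
    (h : ∀ e ∈ offClosure M I, ∑ f ∈ offClosure M (insert e I), v f = 0) :
    ClassSumsVanish M v I := by
  classical
  intro e he
  have h1 : ∀ e ∈ offClosure M I,
      ∑ f ∈ offClosure M I with M.closure (insert f I) = M.closure (insert e I), v f =
        ∑ f ∈ offClosure M I, v f := by
    intro e he
    have := h e he
    rw [sum_offClosure_insert hI.subset_ground] at this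
    linarith
  obtain ⟨g, hg⟩ := exists_mem_offClosure_insert hI hr he
  rw [h1 e he]
  exact sum_eq_zero_of_fiber_sums_eq h1 he (mem_offClosure_of_insert hg)
    (closure_ne_of_mem_offClosure_insert hI.subset_ground hg)

/-- Work inside a rank-two flat F over I. Deleting the class of e' from the part S of F off the
closure of I leaves one parallel class of the contraction by `insert e' I`, whose sum is zero. So
every class in S sums to the total over S, and S contains two classes. -/
theorem ClassSumsVanish.of_insert {v : α → ℝ} {I : Set α} (hI : M.Indep I)
    (hr : I.ncard + 2 ≤ rk M) (h : ∀ e ∈ offClosure M I, ClassSumsVanish M v (insert e I)) :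
    ClassSumsVanish M v I := by
  classical
  intro e he
  obtain ⟨g, hg⟩ := exists_mem_offClosure_insert hI hr he
  have hne := closure_ne_of_mem_offClosure_insert hI.subset_ground hg
  have hgI := mem_offClosure_of_insert hg
  have hE : insert g (insert e I) ⊆ M.E := Set.insert_subset (mem_offClosure.1 hg).1
    (Set.insert_subset (mem_offClosure.1 he).1 hI.subset_ground)
  set F := M.closure (insert g (insert e I)) with hF
  set S := {f ∈ offClosure M I | f ∈ F} with hS
  have heS : e ∈ S := Finset.mem_filter.2 ⟨he, M.mem_closure_of_mem (by simp) hE⟩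
  have hgS : g ∈ S := Finset.mem_filter.2 ⟨hgI, M.mem_closure_of_mem (by simp) hE⟩
  have hmem : ∀ e' ∈ S, ∀ f ∈ offClosure M I,
      M.closure (insert f I) = M.closure (insert e' I) → f ∈ S := by
    intro e' he' f hf hfe
    refine Finset.mem_filter.2 ⟨hf, ?_⟩
    have h1 : f ∈ M.closure (insert e' I) := by
      rw [← hfe]
      exact M.mem_closure_of_mem (by simp)
        (Set.insert_subset (mem_offClosure.1 hf).1 hI.subset_ground)
    refine M.closure_subset_closure_of_subset_closure (Set.insert_subset ?_ ?_) h1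
    · exact (Finset.mem_filter.1 he').2
    · exact fun x hx => M.mem_closure_of_mem (by simp [hx]) hE
  have hclass : ∀ e' ∈ S,
      ∑ f ∈ S with M.closure (insert f I) = M.closure (insert e' I), v f =
      ∑ f ∈ offClosure M I with M.closure (insert f I) = M.closure (insert e' I), v f := by
    intro e' he'
    refine Finset.sum_congr ?_ fun _ _ => rfl
    ext f
    simp only [Finset.mem_filter]
    exact ⟨fun hf => ⟨(Finset.mem_filter.1 hf.1).1, hf.2⟩,
      fun hf => ⟨hmem e' he' f hf.1 hf.2, hf.2⟩⟩
  have hsum : ∀ e' ∈ S,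
      ∑ f ∈ S with M.closure (insert f I) = M.closure (insert e' I), v f = ∑ f ∈ S, v f := by
    intro e' he'
    have he'' := Finset.mem_filter.1 he'
    have he'I := (mem_offClosure.1 he''.1).2
    obtain ⟨g', hg'S, hg'⟩ : ∃ g' ∈ S, g' ∉ M.closure (insert e' I) := by
      by_cases hc : e ∈ M.closure (insert e' I)
      · refine ⟨g, hgS, ?_⟩
        rw [← M.closure_insert_congr ⟨hc, (mem_offClosure.1 he).2⟩]
        exact (mem_offClosure.1 hg).2
      · exact ⟨e, heS, hc⟩
    have hg'F := (Finset.mem_filter.1 hg'S).2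
    have hQ := h e' he''.1 g'
      (mem_offClosure.2 ⟨(mem_offClosure.1 (Finset.mem_filter.1 hg'S).1).1, hg'⟩)
    rw [closure_insert_insert_eq he''.2 he'I hg'F hg', ← hF] at hQ
    rw [← Finset.sum_filter_add_sum_filter_not S
      (fun f => M.closure (insert f I) = M.closure (insert e' I)) v, left_eq_add, ← hQ]
    refine Finset.sum_congr ?_ fun _ _ => rfl
    ext f
    simp only [hS, Finset.mem_filter, offClosure_insert]
    constructor
    · rintro ⟨⟨hf, hfF⟩, hfe⟩
      have hf' := mem_offClosure.1 hf
      have hfe' : f ∉ M.closure (insert e' I) := fun hc =>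
        hfe ((mem_closure_insert_iff_closure_eq hf'.1 hf'.2 hI.subset_ground).1 hc)
      exact ⟨⟨hf, hfe'⟩, closure_insert_insert_eq he''.2 he'I hfF hfe'⟩
    · rintro ⟨⟨hf, hfe'⟩, hfF⟩
      have hf' := mem_offClosure.1 hf
      refine ⟨⟨hf, ?_⟩, fun hc => hfe'
        ((mem_closure_insert_iff_closure_eq hf'.1 hf'.2 hI.subset_ground).2 hc)⟩
      rw [← hfF]
      exact M.mem_closure_of_mem (by simp) (Set.insert_subset hf'.1
        (Set.insert_subset (mem_offClosure.1 he''.1).1 hI.subset_ground))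
  rw [← hclass e heS, hsum e heS]
  exact sum_eq_zero_of_fiber_sums_eq hsum heS hgS hne

theorem mixed_single {I : Set α} {e : α} (he : e ∈ offClosure M I) (l : List (α → ℝ))
    [DecidableEq α] : mixed M (Pi.single e 1 :: l) I = mixed M l (insert e I) := by
  rw [mixed_cons, Finset.sum_eq_single_of_mem e he]
  · simp
  · intro f _ hf
    simp [hf]

theorem mixed_replicate_pos {u : α → ℝ} (hu : ∀ e ∈ M.E, 0 < u e) {n : ℕ} {I : Set α}
    (hI : M.Indep I) (hr : I.ncard + n ≤ rk M) : 0 < mixed M (List.replicate n u) I :=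
  mixed_pos (fun w hw => by rw [List.eq_of_mem_replicate hw]; exact isSpanningWeight_of_pos hu) hI
    (by simpa using hr)

theorem mixed_replicate_mul_le_sq {u : α → ℝ} (hu : ∀ e ∈ M.E, 0 < u e) {k : ℕ} {I : Set α}
    (hI : M.Indep I) (hr : I.ncard + k + 2 ≤ rk M) (v : α → ℝ) :
    mixed M (v :: v :: List.replicate k u) I * mixed M (u :: u :: List.replicate k u) I ≤
      mixed M (v :: u :: List.replicate k u) I ^ 2 :=
  mixed_mul_mixed_le_sq (fun w hw => by rwa [List.eq_of_mem_replicate hw]) hI (by simpa using hr)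
    hu v

theorem mixed_insert_eq_zero {u v : α → ℝ} (hu : ∀ e ∈ M.E, 0 < u e) {k : ℕ}
    {I : Set α} (hI : M.Indep I) (hr : I.ncard + k + 2 ≤ rk M)
    (h1 : mixed M (v :: u :: List.replicate k u) I = 0)
    (h2 : mixed M (v :: v :: List.replicate k u) I = 0) {e : α} (he : e ∈ offClosure M I) :
    mixed M (v :: List.replicate k u) (insert e I) = 0 := by
  classical
  have := eq_zero_of_isotropic (mixedForm M (List.replicate k u) I) (mixedForm_comm _ _) (u := u)
    (mixed_replicate_pos hu (n := k + 2) hI (by omega)) (mixed_replicate_mul_le_sq hu hI hr) h1 h2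
    (Pi.single e 1)
  rwa [mixedForm_apply, mixed_single he] at this

/-- The equality case of the Alexandrov–Fenchel inequality at a positive vector. -/
theorem classSumsVanish_of_mixed_eq_zero {u v : α → ℝ} (hu : ∀ e ∈ M.E, 0 < u e) (k : ℕ)
    {I : Set α} (hI : M.Indep I) (hr : I.ncard + k + 2 ≤ rk M)
    (h1 : mixed M (v :: u :: List.replicate k u) I = 0)
    (h2 : mixed M (v :: v :: List.replicate k u) I = 0) : ClassSumsVanish M v I := by
  induction k generalizing I with
  | zero =>
    refine ClassSumsVanish.of_sum_eq_zero hI (by omega) fun e he => ?_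
    simpa [mixed_cons, mixed_nil] using mixed_insert_eq_zero hu hI hr h1 h2 he
  | succ k ih =>
    have hker : ∀ e ∈ offClosure M I, mixed M (v :: u :: List.replicate k u) (insert e I) = 0 :=
      fun e he => mixed_insert_eq_zero hu hI hr h1 h2 he
    -- Orthogonality to u in each contraction makes these values nonpositive; their sum with the
    -- positive weights u is zero by `h2`, so each vanishes and the induction hypothesis applies.
    have hstep : ∀ e ∈ offClosure M I, mixed M (v :: v :: List.replicate k u) (insert e I) ≤ 0 := by
      intro e he
      obtain ⟨h3, h4⟩ := insert_indep_of_mem_offClosure hI he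
      have h5 := mixed_replicate_mul_le_sq hu h3 (k := k) (by omega) v
      rw [hker e he] at h5
      have h7 : 0 < mixed M (u :: u :: List.replicate k u) (insert e I) :=
        mixed_replicate_pos hu (n := k + 2) h3 (by omega)
      by_contra hc
      push Not at hc
      nlinarith [mul_pos hc h7]
    have h8 : mixed M (u :: v :: v :: List.replicate k u) I = 0 := by
      rw [← h2]
      exact (mixed_perm (List.perm_middle (l₁ := [v, v])) I).symm
    rw [mixed_cons, Finset.sum_eq_zero_iff_of_nonpos fun e he => mul_nonpos_of_nonneg_of_nonpos
      (hu e (mem_offClosure.1 he).1).le (hstep e he)] at h8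
    refine ClassSumsVanish.of_insert hI (by omega) fun e he => ?_
    obtain ⟨h3, h4⟩ := insert_indep_of_mem_offClosure hI he
    exact ih h3 (by omega) (hker e he)
      ((mul_eq_zero.1 (h8 e he)).resolve_left (hu e (mem_offClosure.1 he).1).ne')

end ClassSums

/-! ### From the mixed form to counts of bases. -/

section Counting

variable {α : Type*} {M : Matroid α} [M.Finite]

open Classical in
/-- The independent sets obtained from `I` by adding `a` elements of `R` and `b` elements outside
`R`. -/
noncomputable def extensions (M : Matroid α) [M.Finite] (R : Set α) (a b : ℕ) (I : Set α) :
    Finset (Set α) :=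
  {A ∈ M.ground_finite.finite_subsets.toFinset |
    M.Indep A ∧ I ⊆ A ∧ ((A \ I) ∩ R).ncard = a ∧ ((A \ I) ∩ Rᶜ).ncard = b}

theorem mem_extensions {R : Set α} {a b : ℕ} {I A : Set α} :
    A ∈ extensions M R a b I ↔
      M.Indep A ∧ I ⊆ A ∧ ((A \ I) ∩ R).ncard = a ∧ ((A \ I) ∩ Rᶜ).ncard = b := by
  simp only [extensions, Finset.mem_filter, Set.Finite.mem_toFinset, Set.mem_ofPred_eq,
    and_iff_right_iff_imp]
  exact fun h => h.1.subset_ground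

theorem extensions_compl (R : Set α) (a b : ℕ) (I : Set α) :
    extensions M Rᶜ a b I = extensions M R b a I := by
  ext A
  simp only [mem_extensions, compl_compl]
  tauto

theorem extensions_zero_zero (R : Set α) {I : Set α} (hI : M.Indep I) :
    extensions M R 0 0 I = {I} := by
  ext A
  rw [mem_extensions, Finset.mem_singleton]
  constructor
  · rintro ⟨hA, hIA, h1, h2⟩
    have hfin : (A \ I).Finite := (M.ground_finite.subset hA.subset_ground).subset Set.sdiff_subset
    rw [Set.ncard_eq_zero (hfin.subset Set.inter_subset_left)] at h1 h2
    refine Set.Subset.antisymm (fun x hx => ?_) hIA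
    by_contra hxI
    by_cases hxR : x ∈ R
    · exact Set.notMem_empty x (h1 ▸ ⟨⟨hx, hxI⟩, hxR⟩)
    · exact Set.notMem_empty x (h2 ▸ ⟨⟨hx, hxI⟩, hxR⟩)
  · rintro rfl
    simp [hI]

theorem mem_extensions_insert_iff {R : Set α} {a b : ℕ} {I A : Set α} (hI : M.Indep I) {e : α} :
    ((e ∈ offClosure M I ∧ e ∈ R) ∧ A ∈ extensions M R a b (insert e I)) ↔
      (e ∈ (A \ I) ∩ R ∧ A ∈ extensions M R (a + 1) b I) := by
  rw [mem_extensions, mem_extensions, mem_offClosure]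
  have hset : A \ insert e I = (A \ I) \ {e} := by
    rw [Set.insert_eq, Set.union_comm, Set.sdiff_sdiff]
  have hcount : M.Indep A → e ∈ A \ I → e ∈ R →
      ((A \ I) ∩ R).ncard = ((A \ insert e I) ∩ R).ncard + 1 ∧
      ((A \ insert e I) ∩ Rᶜ) = ((A \ I) ∩ Rᶜ) := by
    intro hA he heR
    have hfin : (A \ I).Finite := (M.ground_finite.subset hA.subset_ground).subset Set.sdiff_subset
    constructor
    · have h : (A \ insert e I) ∩ R = ((A \ I) ∩ R) \ {e} := by
        rw [hset]
        ext x
        simp only [Set.mem_inter_iff, Set.mem_sdiff]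
        tauto
      rw [h, Set.ncard_sdiff_singleton_add_one (Set.mem_inter he heR)
        (hfin.subset Set.inter_subset_left)]
    · ext x
      simp only [hset, Set.mem_inter_iff, Set.mem_sdiff, Set.mem_singleton_iff, Set.mem_compl_iff]
      constructor
      · tauto
      · rintro ⟨h1, h2⟩
        exact ⟨⟨h1, fun h => h2 (h ▸ heR)⟩, h2⟩
  constructor
  · rintro ⟨⟨⟨heE, heI⟩, heR⟩, hA, hIA, h1, h2⟩
    have heA : e ∈ A \ I :=
      ⟨hIA (Set.mem_insert _ _), fun h => heI (M.mem_closure_of_mem h hI.subset_ground)⟩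
    obtain ⟨h3, h4⟩ := hcount hA heA heR
    exact ⟨⟨heA, heR⟩, hA, (Set.subset_insert _ _).trans hIA, by omega, by rw [← h4, h2]⟩
  · rintro ⟨⟨heA, heR⟩, hA, hIA, h1, h2⟩
    have hins : insert e I ⊆ A := Set.insert_subset heA.1 hIA
    have heE : e ∈ M.E := hA.subset_ground heA.1
    obtain ⟨h3, h4⟩ := hcount hA heA heR
    exact ⟨⟨⟨heE, (hI.notMem_closure_iff heE).2 ⟨hA.subset hins, heA.2⟩⟩, heR⟩, hA, hins,
      by omega, by rw [h4, h2]⟩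

/-- Double counting: any of the a + 1 new elements of A in R may be the one added first. -/
theorem sum_card_extensions (R : Set α) (a b : ℕ) {I : Set α} (hI : M.Indep I) :
    ∑ e ∈ offClosure M I, R.indicator (1 : α → ℝ) e * (extensions M R a b (insert e I)).card =
      (a + 1) * (extensions M R (a + 1) b I).card := by
  classical
  have h1 : ∑ e ∈ offClosure M I,
      R.indicator (1 : α → ℝ) e * (extensions M R a b (insert e I)).card =
      ∑ e ∈ offClosure M I with e ∈ R, ∑ _A ∈ extensions M R a b (insert e I), (1 : ℝ) := by
    rw [Finset.sum_filter]
    refine Finset.sum_congr rfl fun e _ => ?_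
    by_cases h : e ∈ R <;> simp [h]
  rw [h1, Finset.sum_comm' (t' := extensions M R (a + 1) b I)
    (s' := fun A => {e ∈ M.ground_finite.toFinset | e ∈ (A \ I) ∩ R})]
  · rw [Finset.sum_congr rfl (g := fun _ => ((a : ℝ) + 1))]
    · rw [Finset.sum_const, nsmul_eq_mul, mul_comm]
    · intro A hA
      rw [mem_extensions] at hA
      have h2 : (({e ∈ M.ground_finite.toFinset | e ∈ (A \ I) ∩ R} : Finset α) : Set α) =
          (A \ I) ∩ R := by
        ext x
        simp only [Finset.coe_filter, Set.Finite.mem_toFinset, Set.mem_ofPred_eq,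
          and_iff_right_iff_imp]
        exact fun h => hA.1.subset_ground h.1.1
      have h3 := Set.ncard_coe_finset {e ∈ M.ground_finite.toFinset | e ∈ (A \ I) ∩ R}
      rw [h2, hA.2.2.1] at h3
      rw [Finset.sum_const, ← h3]
      simp
  · intro e A
    have h4 := mem_extensions_insert_iff (R := R) (a := a) (b := b) (A := A) hI (e := e)
    rw [Finset.mem_filter, h4, Finset.mem_filter, Set.Finite.mem_toFinset]
    refine ⟨fun h => ⟨⟨?_, h.1⟩, h.2⟩, fun h => ⟨h.1.2, h.2⟩⟩
    exact (mem_extensions.1 h.2).1.subset_ground h.1.1.1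

theorem mixed_indicator (R : Set α) (a b : ℕ) {I : Set α} (hI : M.Indep I) :
    mixed M (List.replicate a (R.indicator 1) ++ List.replicate b (Rᶜ.indicator 1)) I =
      a.factorial * b.factorial * (extensions M R a b I).card := by
  induction a generalizing I with
  | zero =>
    induction b generalizing I with
    | zero => simp [mixed_nil, extensions_zero_zero R hI]
    | succ b ih =>
      simp only [List.replicate_zero, List.nil_append, List.replicate_succ] at ih ⊢
      rw [mixed_cons, Finset.sum_congr rfl fun e he => by
        rw [ih (insert_indep_of_mem_offClosure hI he).1, ← extensions_compl]]
      have h := sum_card_extensions (M := M) Rᶜ b 0 hI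
      rw [extensions_compl R (b + 1)] at h
      rw [Nat.factorial_succ]
      push_cast
      rw [mul_comm ((b : ℝ) + 1), ← mul_assoc, mul_assoc, ← h, Finset.mul_sum]
      exact Finset.sum_congr rfl fun e _ => by ring
  | succ a ih =>
    rw [List.replicate_succ, List.cons_append, mixed_cons, Finset.sum_congr rfl fun e he => by
        rw [ih (insert_indep_of_mem_offClosure hI he).1]]
    have h := sum_card_extensions (M := M) R a b hI
    have h2 : (((a + 1).factorial : ℕ) : ℝ) * b.factorial * (extensions M R (a + 1) b I).card =
        a.factorial * b.factorial * (((a : ℝ) + 1) * (extensions M R (a + 1) b I).card) := by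
      rw [Nat.factorial_succ]
      push_cast
      ring
    rw [h2, ← h, Finset.mul_sum]
    exact Finset.sum_congr rfl fun e _ => by ring

theorem isBase_iff_indep_ncard {A : Set α} : M.IsBase A ↔ M.Indep A ∧ A.ncard = rk M := by
  refine ⟨fun h => ⟨h.indep, ncard_eq_rk h⟩, fun ⟨h, hr⟩ => ?_⟩
  obtain ⟨C, hC, hAC⟩ := h.exists_isBase_superset
  have := Set.eq_of_subset_of_ncard_le hAC (by rw [hr, ncard_eq_rk hC])
    (M.ground_finite.subset hC.subset_ground)
  rwa [this]

theorem coe_extensions_empty (R : Set α) {a : ℕ} (ha : a ≤ rk M) :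
    (extensions M R a (rk M - a) ∅ : Set (Set α)) = basesMeeting M R a := by
  ext A
  simp only [Finset.mem_coe, mem_extensions, basesMeeting, Set.mem_ofPred_eq, Set.sdiff_empty,
    Set.empty_subset, true_and, isBase_iff_indep_ncard]
  constructor
  · rintro ⟨hA, h1, h2⟩
    have := Set.ncard_inter_add_ncard_sdiff_eq_ncard A R (M.ground_finite.subset hA.subset_ground)
    rw [Set.sdiff_eq] at this
    exact ⟨⟨hA, by omega⟩, h1⟩
  · rintro ⟨⟨hA, h1⟩, h2⟩
    have := Set.ncard_inter_add_ncard_sdiff_eq_ncard A R (M.ground_finite.subset hA.subset_ground)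
    rw [Set.sdiff_eq] at this
    exact ⟨hA, h2, by omega⟩

theorem mixed_indicator_eq_P (R : Set α) {a : ℕ} (ha : a ≤ rk M) :
    mixed M (List.replicate a (R.indicator 1) ++ List.replicate (rk M - a) (Rᶜ.indicator 1)) ∅ =
      (rk M).factorial * ((P M R a : ℚ) : ℝ) := by
  rw [mixed_indicator R a _ M.empty_indep, P, B, ← coe_extensions_empty R ha,
    Set.ncard_coe_finset, ← Nat.choose_mul_factorial_mul_factorial ha]
  have : (((rk M).choose a : ℕ) : ℝ) ≠ 0 := by exact_mod_cast (Nat.choose_pos ha).ne'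
  push_cast
  field_simp

end Counting

/-! ### Geometric and log-concave sequences. -/

section Sequences

/-- `m 0, …, m r` is a geometric sequence with positive ratio. -/
def IsGeometricUpTo (m : ℕ → ℝ) (r : ℕ) : Prop :=
  ∃ c : ℝ, 0 < c ∧ ∀ a < r, m (a + 1) = c * m a

theorem IsGeometricUpTo.exists_eq_pow {m : ℕ → ℝ} {r : ℕ} (h : IsGeometricUpTo m r) :
    ∃ c : ℝ, 0 < c ∧ ∀ a ≤ r, m a = c ^ a * m 0 := by
  obtain ⟨c, hc, h⟩ := h
  refine ⟨c, hc, fun a ha => ?_⟩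
  induction a with
  | zero => simp
  | succ a ih => rw [h a (by omega), ih (by omega)]; ring

theorem isGeometricUpTo_iff_forall_sq {m : ℕ → ℝ} {r : ℕ} (hr : 1 ≤ r)
    (hm : ∀ a ≤ r, 0 < m a) :
    IsGeometricUpTo m r ↔ ∀ a ∈ Set.Icc 1 (r - 1), m a ^ 2 = m (a + 1) * m (a - 1) := by
  constructor
  · intro h a ⟨h1, h2⟩
    obtain ⟨c, -, h⟩ := h.exists_eq_pow
    obtain ⟨b, rfl⟩ := Nat.exists_eq_add_of_le' h1
    rw [h (b + 1) (by omega), h (b + 1 + 1) (by omega), h (b + 1 - 1) (by omega),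
      Nat.add_sub_cancel]
    ring
  · intro h
    have h0 := hm 0 (by omega)
    refine ⟨m 1 / m 0, div_pos (hm 1 hr) h0, fun a ha => ?_⟩
    induction a with
    | zero => rw [div_mul_cancel₀ _ h0.ne']
    | succ a ih =>
      have h1 := h (a + 1) ⟨by omega, by omega⟩
      rw [Nat.add_sub_cancel] at h1
      have h2 := ih (by omega)
      have h3 := hm a (by omega)
      refine mul_right_cancel₀ h3.ne' ?_
      rw [← h1, sq]
      nth_rewrite 2 [h2]
      ring

/-- Log-concavity bounds all successive ratios by the first, c; they multiply to m r / m 0, which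
the equation makes c ^ r, so none can be smaller. -/
theorem isGeometricUpTo_iff_pow_eq {m : ℕ → ℝ} {r : ℕ} (hr : 1 ≤ r) (hm : ∀ a ≤ r, 0 < m a)
    (hlc : ∀ a, a + 2 ≤ r → m a * m (a + 2) ≤ m (a + 1) ^ 2) :
    IsGeometricUpTo m r ↔ m 1 ^ r = m 0 ^ (r - 1) * m r := by
  constructor
  · intro h
    obtain ⟨c, -, h⟩ := h.exists_eq_pow
    rw [h 1 hr, h r le_rfl]
    obtain ⟨n, rfl⟩ := Nat.exists_eq_add_of_le' hr
    rw [Nat.add_sub_cancel]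
    ring
  · intro h
    have h0 := hm 0 (by omega)
    set c := m 1 / m 0 with hc
    have hcpos : 0 < c := div_pos (hm 1 hr) h0
    have hratio : ∀ a < r, m (a + 1) / m a ≤ c := by
      intro a ha
      induction a with
      | zero => exact le_rfl
      | succ a ih =>
        refine le_trans ?_ (ih (by omega))
        rw [div_le_div_iff₀ (hm _ (by omega)) (hm _ (by omega))]
        have := hlc a (by omega)
        nlinarith
    have hprod : ∏ a ∈ Finset.range r, m (a + 1) / m a = ∏ a ∈ Finset.range r, c := by
      have h1 : ∀ n ≤ r, ∏ a ∈ Finset.range n, m (a + 1) / m a = m n / m 0 := by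
        intro n hn
        induction n with
        | zero => simp [h0.ne']
        | succ n ih =>
          rw [Finset.prod_range_succ, ih (by omega)]
          have := (hm n (by omega)).ne'
          field_simp
      rw [h1 r le_rfl, Finset.prod_const, Finset.card_range, hc, div_pow, h]
      obtain ⟨n, rfl⟩ := Nat.exists_eq_add_of_le' hr
      rw [Nat.add_sub_cancel, pow_succ]
      field_simp
    refine ⟨c, hcpos, fun a ha => ?_⟩
    have heq : m (a + 1) / m a = c := by
      by_contra hne
      refine (Finset.prod_lt_prod (fun b hb => ?_) (fun b hb => ?_)
        ⟨a, Finset.mem_range.2 ha, lt_of_le_of_ne (hratio a ha) hne⟩).ne hprod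
      · have := Finset.mem_range.1 hb
        exact div_pos (hm _ (by omega)) (hm _ (by omega))
      · exact hratio b (Finset.mem_range.1 hb)
    rw [← heq, div_mul_cancel₀ _ (hm a (by omega)).ne']

end Sequences

/-! ### Log-concavity of the basis counts. -/

section LogConcavity

variable {α : Type*} {M : Matroid α} [M.Finite]

theorem continuous_mixed_map_add (l : List (α → ℝ)) (I : Set α) :
    Continuous fun ε : ℝ => mixed M (l.map fun w => w + fun _ => ε) I := by
  induction l generalizing I with
  | nil => exact continuous_const
  | cons v l ih =>
    simp only [List.map_cons, mixed_cons, Pi.add_apply]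
    exact continuous_finsetSum _ fun e _ => (continuous_const.add continuous_id).mul (ih _)

/-- Indicator weights are not strictly positive, so add ε to all weights and let ε tend to 0 from
the right. -/
theorem mixed_mul_mixed_le_sq_of_nonneg {l : List (α → ℝ)} {I : Set α} (hI : M.Indep I)
    (hr : I.ncard + l.length + 2 ≤ rk M) {u v : α → ℝ}
    (h : ∀ w ∈ u :: v :: l, ∀ e ∈ M.E, 0 ≤ w e) :
    mixed M (v :: v :: l) I * mixed M (u :: u :: l) I ≤ mixed M (v :: u :: l) I ^ 2 := by
  have hc := fun l' : List (α → ℝ) =>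
    ((continuous_mixed_map_add (M := M) l' I).tendsto 0).mono_left
      (nhdsWithin_le_nhds (s := Set.Ioi (0 : ℝ)))
  have hz : ∀ l' : List (α → ℝ), (l'.map fun w => w + fun _ => (0 : ℝ)) = l' := by
    intro l'
    have : (fun w : α → ℝ => w + fun _ => (0 : ℝ)) = id := by
      funext w e
      simp
    rw [this, List.map_id]
  simp only [hz] at hc
  refine le_of_tendsto_of_tendsto ((hc (v :: v :: l)).mul (hc (u :: u :: l)))
    ((hc (v :: u :: l)).pow 2) ?_
  filter_upwards [self_mem_nhdsWithin] with ε hε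
  have hpos : ∀ w ∈ u :: v :: l, ∀ e ∈ M.E, 0 < (w + (fun _ => ε : α → ℝ)) e := fun w hw e he =>
    add_pos_of_nonneg_of_pos (h w hw e he) hε
  refine mixed_mul_mixed_le_sq (fun w hw => ?_) hI (by simpa using hr) (hpos u (by simp)) _
  obtain ⟨t, ht, rfl⟩ := List.mem_map.1 hw
  exact hpos t (by simp [ht])

/-- The number of ordered bases with prescribed positions of the elements of `R`. -/
noncomputable def orderedBases (M : Matroid α) [M.Finite] (R : Set α) (a : ℕ) : ℝ :=
  mixed M (List.replicate a (R.indicator 1) ++ List.replicate (rk M - a) (Rᶜ.indicator 1)) ∅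

theorem mixed_eq_orderedBases (R : Set α) {a b : ℕ} (hab : a + b = rk M) {l : List (α → ℝ)}
    (hl : l.Perm (List.replicate a (R.indicator 1) ++ List.replicate b (Rᶜ.indicator 1))) :
    mixed M l ∅ = orderedBases M R a := by
  rw [mixed_perm hl, orderedBases]
  congr
  omega

theorem perm_replicate_append {β : Type*} {p q : β} {l : List β} (h : ∀ w ∈ l, w = p ∨ w = q) :
    ∃ a b, a + b = l.length ∧ l.Perm (List.replicate a p ++ List.replicate b q) := by
  induction l with
  | nil => exact ⟨0, 0, rfl, List.Perm.refl _⟩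
  | cons w l ih =>
    obtain ⟨a, b, hab, hl⟩ := ih fun w hw => h w (List.mem_cons_of_mem _ hw)
    rcases h w (by simp) with rfl | rfl
    · exact ⟨a + 1, b, by simp; omega, hl.cons _⟩
    · exact ⟨a, b + 1, by simp; omega, (hl.cons _).trans List.perm_middle.symm⟩

theorem orderedBases_logConcave (R : Set α) {a : ℕ} (ha : a + 2 ≤ rk M) :
    orderedBases M R a * orderedBases M R (a + 2) ≤ orderedBases M R (a + 1) ^ 2 := by
  set p : α → ℝ := R.indicator 1
  set q : α → ℝ := Rᶜ.indicator 1
  set l := List.replicate a p ++ List.replicate (rk M - a - 2) q with hl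
  have hp : ∀ e, 0 ≤ p e := fun e => Set.indicator_nonneg (fun _ _ => zero_le_one) e
  have hq : ∀ e, 0 ≤ q e := fun e => Set.indicator_nonneg (fun _ _ => zero_le_one) e
  have h := mixed_mul_mixed_le_sq_of_nonneg (l := l) (u := p) (v := q) M.empty_indep
    (by simp [hl]; omega) (fun w hw e _ => by
      simp only [hl, List.mem_cons, List.mem_append, List.mem_replicate] at hw
      rcases hw with rfl | rfl | ⟨-, rfl⟩ | ⟨-, rfl⟩
      exacts [hp e, hq e, hp e, hq e])
  have hqq : ∀ b k, (List.replicate k p ++ List.replicate (b + 1) q).Perm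
      (q :: (List.replicate k p ++ List.replicate b q)) := fun b k => List.perm_middle
  rwa [mixed_eq_orderedBases R (a := a) (b := rk M - a - 2 + 1 + 1) (by omega)
      (((hqq _ _).trans ((hqq _ _).cons q)).symm),
    mixed_eq_orderedBases R (l := p :: p :: l) (a := a + 2) (b := rk M - a - 2) (by omega)
      (List.Perm.refl _),
    mixed_eq_orderedBases R (l := q :: p :: l) (a := a + 1) (b := rk M - a - 2 + 1) (by omega)
      (hqq _ (a + 1)).symm] at h

theorem orderedBases_pos {R : Set α} (hp : IsSpanningWeight M (R.indicator 1))
    (hq : IsSpanningWeight M (Rᶜ.indicator 1)) {a : ℕ} (ha : a ≤ rk M) :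
    0 < orderedBases M R a := by
  refine mixed_pos (fun w hw => ?_) M.empty_indep (by simp; omega)
  simp only [List.mem_append, List.mem_replicate] at hw
  rcases hw with ⟨-, rfl⟩ | ⟨-, rfl⟩
  exacts [hp, hq]

end LogConcavity

/-! ### Geometric sequences and balanced parallel classes. -/

section Geometric

variable {α : Type*} {M : Matroid α}

theorem nonempty_basesMeeting_of_P_pos {R : Set α} {a : ℕ} (h : 0 < P M R a) :
    ∃ A, M.IsBase A ∧ (A ∩ R).ncard = a := by
  have : B M R a ≠ 0 := by
    intro h0
    simp [P, h0] at h
  exact Set.nonempty_of_ncard_ne_zero this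

theorem isSpanningWeight_indicator {R A : Set α} (hA : M.IsBase A) (hAR : A ⊆ R) :
    IsSpanningWeight M (R.indicator 1) :=
  ⟨fun e _ => Set.indicator_nonneg (fun _ _ => zero_le_one) e, A, hA, fun e he => by
    simp [hAR he]⟩

variable [M.Finite]

theorem mixed_sub_smul (v w : α → ℝ) (c : ℝ) (l : List (α → ℝ)) (I : Set α) :
    mixed M ((v - c • w) :: l) I = mixed M (v :: l) I - c * mixed M (w :: l) I := by
  rw [sub_eq_add_neg, ← neg_smul, mixed_add, mixed_smul]
  ring

theorem ClassSumsVanish.mixed_eq_zero {v : α → ℝ} {I : Set α} (h : ClassSumsVanish M v I)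
    (l : List (α → ℝ)) : mixed M (v :: l) I = 0 := by
  classical
  rw [mixed_cons, ← Finset.sum_fiberwise_of_maps_to
    (t := (offClosure M I).image fun e => M.closure (insert e I))
    (g := fun e => M.closure (insert e I)) (fun e he => Finset.mem_image_of_mem _ he)]
  refine Finset.sum_eq_zero fun c hc => ?_
  obtain ⟨e, he, rfl⟩ := Finset.mem_image.1 hc
  rw [Finset.sum_congr rfl (g := fun f => v f * mixed M l (insert e I)), ← Finset.sum_mul, h e he,
    zero_mul]
  intro f hf
  rw [mixed_congr_closure l (Finset.mem_filter.1 hf).2]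

/-- With p - c • q in one slot, `mixed` equals the difference of the two sides of the recurrence.
The converse direction is where the equality case of Alexandrov–Fenchel enters, at the positive
vector p + q. -/
theorem classSumsVanish_iff {R : Set α} {c : ℝ} (hr : 2 ≤ rk M) :
    ClassSumsVanish M (R.indicator 1 - c • Rᶜ.indicator 1) ∅ ↔
      ∀ a < rk M, orderedBases M R (a + 1) = c * orderedBases M R a := by
  set p : α → ℝ := R.indicator 1 with hp
  set q : α → ℝ := Rᶜ.indicator 1 with hq
  have hcons : ∀ a b, a + b + 1 = rk M → ∀ l, l.Perm (List.replicate a p ++ List.replicate b q) →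
      mixed M ((p - c • q) :: l) ∅ = orderedBases M R (a + 1) - c * orderedBases M R a := by
    intro a b hab l hl
    rw [mixed_sub_smul, mixed_eq_orderedBases R (a := a + 1) (b := b) (by omega) (hl.cons p),
      mixed_eq_orderedBases R (a := a) (b := b + 1) (by omega)
        ((hl.cons q).trans List.perm_middle.symm)]
  constructor
  · intro h a ha
    have := hcons a (rk M - a - 1) (by omega) _ (List.Perm.refl _)
    rw [h.mixed_eq_zero] at this
    linarith
  · intro h
    -- Induction on the number n of slots p + q still to be expanded by multilinearity into p and q.
    have hzero : ∀ n l, (∀ w ∈ l, w = p ∨ w = q) → n + l.length + 1 = rk M →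
        mixed M ((p - c • q) :: (List.replicate n (p + q) ++ l)) ∅ = 0 := by
      intro n
      induction n with
      | zero =>
        intro l hl hn
        obtain ⟨a, b, hab, hperm⟩ := perm_replicate_append hl
        rw [List.replicate_zero, List.nil_append, hcons a b (by omega) l hperm, h a (by omega),
          sub_self]
      | succ n ih =>
        intro l hl hn
        have hmove : ∀ w, w = p ∨ w = q →
            mixed M (w :: (p - c • q) :: (List.replicate n (p + q) ++ l)) ∅ = 0 := by
          intro w hw
          rw [mixed_swap, ← ih (w :: l) (fun w' hw' => ?_) (by simp; omega)]
          · exact mixed_perm (List.perm_middle.symm.cons _) _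
          · rcases List.mem_cons.1 hw' with rfl | h'
            exacts [hw, hl _ h']
        rw [List.replicate_succ, List.cons_append, mixed_swap, mixed_add, hmove p (Or.inl rfl),
          hmove q (Or.inr rfl), add_zero]
    have hu : ∀ e ∈ M.E, 0 < (p + q) e := by
      intro e _
      simp [hp, hq]
    refine classSumsVanish_of_mixed_eq_zero hu (rk M - 2) M.empty_indep (by simp; omega) ?_ ?_
    · have := hzero (rk M - 2 + 1) [] (by simp) (by simp; omega)
      rwa [List.append_nil] at this
    · have hmove : ∀ w, w = p ∨ w = q →
          mixed M (w :: (p - c • q) :: List.replicate (rk M - 2) (p + q)) ∅ = 0 := by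
        intro w hw
        rw [mixed_swap, ← hzero (rk M - 2) [w] (by simpa using hw) (by simp; omega)]
        exact mixed_perm ((List.perm_append_singleton _ _).symm.cons _) _
      rw [mixed_sub_smul, hmove p (Or.inl rfl), hmove q (Or.inr rfl)]
      ring

theorem mem_Par_iff (hM : M.Loopless) {x y : α} (hx : x ∈ M.E) :
    y ∈ Par M x ↔ y ∈ offClosure M ∅ ∧ M.closure (insert y ∅) = M.closure (insert x ∅) := by
  have hloops : M.closure ∅ = ∅ := hM.loops_eq_empty
  simp only [Par, Set.mem_ofPred_eq, mem_offClosure, hloops, Set.mem_empty_iff_false,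
    not_false_eq_true, and_true]
  have hnl : M.IsNonloop y ↔ y ∈ M.E := ⟨fun h => h.mem_ground, fun h => M.isNonloop_of_loopless h⟩
  rw [hnl]
  refine and_congr_right fun hy => ?_
  rw [← mem_closure_insert_iff_closure_eq hy (by simp [hloops]) (Set.empty_subset _)]
  have hix : M.Indep {x} := (M.isNonloop_of_loopless hx).indep
  have h := hix.notMem_closure_iff hy
  rw [insert_empty_eq, ← not_iff_not, h, Set.pair_comm y x, Set.mem_singleton_iff]
  tauto

theorem classSumsVanish_iff_Par (hM : M.Loopless) (R : Set α) (c : ℝ) :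
    ClassSumsVanish M (R.indicator 1 - c • Rᶜ.indicator 1) ∅ ↔
      ∀ x ∈ M.E, ((Par M x ∩ R).ncard : ℝ) = c * ((Par M x ∩ (M.E \ R)).ncard : ℝ) := by
  classical
  have hmem : ∀ x, x ∈ offClosure M ∅ ↔ x ∈ M.E := fun x => by
    rw [mem_offClosure, show M.closure ∅ = ∅ from hM.loops_eq_empty]
    simp
  unfold ClassSumsVanish
  simp only [hmem]
  refine forall₂_congr fun x hx => ?_
  set C : Finset α := {f ∈ offClosure M ∅ | M.closure (insert f ∅) = M.closure (insert x ∅)}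
  have hC : ∀ y, y ∈ C ↔ y ∈ Par M x := fun y => by
    rw [mem_Par_iff hM hx, Finset.mem_filter]
  have hsum : ∀ T S : Set α, (∀ y ∈ M.E, y ∈ T ↔ y ∈ S) →
      ∑ f ∈ C, T.indicator (1 : α → ℝ) f = (Par M x ∩ S).ncard := by
    intro T S hTS
    have h1 : ((C.filter (· ∈ T) : Finset α) : Set α) = Par M x ∩ S := by
      ext y
      rw [Finset.coe_filter, Set.mem_ofPred_eq, hC, Set.mem_inter_iff]
      exact and_congr_right fun h => hTS y h.1.mem_ground
    rw [← h1, Set.ncard_coe_finset, Finset.card_filter]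
    push_cast
    exact Finset.sum_congr rfl fun f _ => by simp [Set.indicator_apply]
  have h2 : ∑ f ∈ C, (R.indicator 1 - c • Rᶜ.indicator 1 : α → ℝ) f =
      (Par M x ∩ R).ncard - c * (Par M x ∩ (M.E \ R)).ncard := by
    rw [← hsum R R (fun _ _ => Iff.rfl),
      ← hsum Rᶜ (M.E \ R) (fun y hy => by simp [hy])]
    simp only [Pi.sub_apply, Pi.smul_apply, smul_eq_mul, Finset.sum_sub_distrib, Finset.mul_sum]
  rw [h2, sub_eq_zero]

theorem equality_conditions_equivalent (hM : M.Loopless) {R : Set α} (hr : 2 ≤ rk M)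
    (h0 : 0 < P M R 0) (h1 : 0 < P M R (rk M)) :
    (P M R 1 ^ rk M = P M R 0 ^ (rk M - 1) * P M R (rk M) ↔
        ∀ a ∈ Set.Icc 1 (rk M - 1), SYEquality M R a) ∧
      ((∀ a ∈ Set.Icc 1 (rk M - 1), SYEquality M R a) ↔
        ∃ s : ℝ, 0 < s ∧ ∀ x ∈ M.E,
          ((Par M x ∩ R).ncard : ℝ) = s * ((Par M x ∩ (M.E \ R)).ncard : ℝ)) := by
  obtain ⟨A, hA, hAR⟩ := nonempty_basesMeeting_of_P_pos h0
  obtain ⟨A', hA', hAR'⟩ := nonempty_basesMeeting_of_P_pos h1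
  have hfin : ∀ {A}, M.IsBase A → A.Finite := fun hA => M.ground_finite.subset hA.subset_ground
  rw [Set.ncard_eq_zero ((hfin hA).subset Set.inter_subset_left)] at hAR
  have hq := isSpanningWeight_indicator (R := Rᶜ) hA
    (fun x hx hxR => Set.notMem_empty x (hAR ▸ ⟨hx, hxR⟩))
  have hp := isSpanningWeight_indicator (R := R) hA' (Set.inter_eq_left.1
    (Set.eq_of_subset_of_ncard_le Set.inter_subset_left (by rw [hAR', ncard_eq_rk hA'])
      (hfin hA')))
  set m : ℕ → ℝ := fun a => ((P M R a : ℚ) : ℝ)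
  have hf : (0 : ℝ) < (rk M).factorial := by exact_mod_cast Nat.factorial_pos _
  have hPm : ∀ a ≤ rk M, orderedBases M R a = (rk M).factorial * m a :=
    fun a ha => mixed_indicator_eq_P R ha
  have hpos : ∀ a ≤ rk M, 0 < m a := fun a ha => by
    have := orderedBases_pos hp hq ha
    rw [hPm a ha] at this
    exact pos_of_mul_pos_right this hf.le
  have hlc : ∀ a, a + 2 ≤ rk M → m a * m (a + 2) ≤ m (a + 1) ^ 2 := fun a ha => by
    have := orderedBases_logConcave R ha
    rw [hPm a (by omega), hPm _ ha, hPm (a + 1) (by omega)] at this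
    refine le_of_mul_le_mul_left ?_ (pow_pos hf 2)
    linarith
  have hi : P M R 1 ^ rk M = P M R 0 ^ (rk M - 1) * P M R (rk M) ↔ IsGeometricUpTo m (rk M) := by
    rw [isGeometricUpTo_iff_pow_eq (by omega) hpos hlc]
    simp only [m]
    norm_cast
  have hii : (∀ a ∈ Set.Icc 1 (rk M - 1), SYEquality M R a) ↔ IsGeometricUpTo m (rk M) := by
    rw [isGeometricUpTo_iff_forall_sq (by omega) hpos]
    refine forall₂_congr fun a _ => ?_
    simp only [m, SYEquality]
    norm_cast
  rw [hi, hii]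
  -- The ratio of the sequence and the constant s are the same number c.
  refine ⟨Iff.rfl, exists_congr fun c => and_congr_right fun _ => ?_⟩
  rw [← classSumsVanish_iff_Par hM, classSumsVanish_iff hr]
  refine forall₂_congr fun a ha => ?_
  rw [hPm a (by omega), hPm (a + 1) (by omega), mul_left_comm]
  exact (mul_right_inj' hf.ne').symm

end Geometric

/-! ### Matroids of vector families and independence over the two-element field. -/

section Representable

variable {α W : Type*} (K : Type*) [Finite α] [Field K] [AddCommGroup W] [Module K W]

/-- If no element of J augmented I, the vectors of J would lie in the span of those of I, giving |J|
≤ |I|. -/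
theorem exists_linearIndepOn_insert {φ : α → W} {I J : Set α} (hI : LinearIndepOn K φ I)
    (hJ : LinearIndepOn K φ J) (h : I.ncard < J.ncard) :
    ∃ e ∈ J, e ∉ I ∧ LinearIndepOn K φ (insert e I) := by
  classical
  by_contra! hc
  have hspan : Set.range (fun x : J => φ x) ⊆ Submodule.span K (φ '' I) := by
    rintro _ ⟨⟨e, he⟩, rfl⟩
    by_cases heI : e ∈ I
    · exact Submodule.subset_span (Set.mem_image_of_mem _ heI)
    · have := hc e he heI
      rw [linearIndepOn_insert heI] at this
      by_contra hn
      exact this ⟨hI, hn⟩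
  have : Fintype (φ '' I) := Fintype.ofFinite _
  have h1 := linearIndependent_le_span' _ hJ (φ '' I) hspan
  have h2 : J.ncard ≤ (φ '' I).ncard := by
    rw [← Nat.card_coe_set_eq, ← Nat.card_coe_set_eq, Nat.card_eq_fintype_card (α := φ '' I)]
    have := Cardinal.toNat_le_toNat h1 (Cardinal.natCast_lt_aleph0)
    simpa [Nat.card] using this
  have h3 := Set.ncard_image_le (f := φ) (Set.toFinite I)
  omega

/-- The matroid represented by a finite family of vectors. -/
def linearMatroid (φ : α → W) : Matroid α :=
  (IndepMatroid.ofFinite Set.finite_univ (LinearIndepOn K φ) (linearIndepOn_empty K φ)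
    (fun _ _ h hIJ => h.mono hIJ) (fun _ _ hI hJ h => exists_linearIndepOn_insert K hI hJ h)
    (fun _ _ => Set.subset_univ _)).matroid

theorem linearMatroid_indep_iff (φ : α → W) (A : Set α) :
    (linearMatroid K φ).Indep A ↔ LinearIndepOn K φ A := by
  simp [linearMatroid]

theorem linearMatroid_finite (φ : α → W) : (linearMatroid K φ).Finite :=
  ⟨Set.toFinite _⟩

end Representable

/-- Coefficients are 0 or 1, so a linear relation is a subset with zero sum. -/
theorem linearIndepOn_zmod_two_iff {α W : Type*} [DecidableEq α] [AddCommGroup W]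
    [Module (ZMod 2) W] (φ : α → W) (A : Finset α) :
    LinearIndepOn (ZMod 2) φ (A : Set α) ↔ ∀ C ∈ A.powerset, C.Nonempty → ∑ i ∈ C, φ i ≠ 0 := by
  rw [linearIndepOn_finset_iff]
  constructor
  · rintro h C hC ⟨i, hi⟩ h0
    have hCA := Finset.mem_powerset.1 hC
    have := h (fun j => if j ∈ C then 1 else 0) (by
      simpa [ite_smul, Finset.sum_ite_mem, Finset.inter_eq_right.2 hCA] using h0) i (hCA hi)
    simp [hi] at this
  · intro h f hf
    by_contra! hc
    obtain ⟨i, hi, hfi⟩ := hc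
    have h01 : ∀ x : ZMod 2, x ≠ 0 → x = 1 := by decide
    refine h {j ∈ A | f j ≠ 0} (by simp) ⟨i, by simp [hi, hfi]⟩ ?_
    rw [← hf, Finset.sum_filter]
    refine Finset.sum_congr rfl fun j _ => ?_
    by_cases hj : f j = 0
    · simp [hj]
    · simp [h01 _ hj]

theorem linearIndepOn_zmod_two_triple_iff {α W : Type*} [DecidableEq α] [AddCommGroup W]
    [Module (ZMod 2) W] (φ : α → W) {i j k : α} (hij : i ≠ j) (hik : i ≠ k) (hjk : j ≠ k) :
    LinearIndepOn (ZMod 2) φ (({i, j, k} : Finset α) : Set α) ↔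
      (φ i ≠ 0 ∧ φ j ≠ 0 ∧ φ k ≠ 0) ∧ (φ i + φ j ≠ 0 ∧ φ i + φ k ≠ 0 ∧ φ j + φ k ≠ 0) ∧
        φ i + φ j + φ k ≠ 0 := by
  rw [linearIndepOn_zmod_two_iff]
  simp only [Finset.mem_powerset]
  constructor
  · intro h
    have hi := h {i} (by simp) (by simp)
    have hj := h {j} (by simp) (by simp)
    have hk := h {k} (by simp) (by simp)
    have h1 := h {i, j} (by grind) (by simp)
    have h2 := h {i, k} (by grind) (by simp)
    have h3 := h {j, k} (by grind) (by simp)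
    have h4 := h {i, j, k} (by grind) (by simp)
    simp only [Finset.sum_singleton] at hi hj hk
    rw [Finset.sum_pair hij] at h1
    rw [Finset.sum_pair hik] at h2
    rw [Finset.sum_pair hjk] at h3
    rw [Finset.sum_insert (by simp [hij, hik]), Finset.sum_pair hjk, ← add_assoc] at h4
    exact ⟨⟨hi, hj, hk⟩, ⟨h1, h2, h3⟩, h4⟩
  · rintro ⟨⟨hi, hj, hk⟩, ⟨h1, h2, h3⟩, h4⟩ C hC hne
    have hsum : ∑ x ∈ C, φ x = (if i ∈ C then φ i else 0) + (if j ∈ C then φ j else 0) +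
        (if k ∈ C then φ k else 0) := by
      rw [← Finset.inter_eq_right.2 hC, ← Finset.sum_ite_mem,
        Finset.sum_insert (by simp [hij, hik]), Finset.sum_pair hjk, ← add_assoc]
      simp
    have hmem : i ∈ C ∨ j ∈ C ∨ k ∈ C := by
      obtain ⟨x, hx⟩ := hne
      have := hC hx
      simp only [Finset.mem_insert, Finset.mem_singleton] at this
      rcases this with rfl | rfl | rfl <;> simp [hx]
    rw [hsum]
    by_cases ci : i ∈ C <;> by_cases cj : j ∈ C <;> by_cases ck : k ∈ C <;> simp_all

/-! ### The Fano plane with a tripled point. -/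

section Example

/-- The points of the Fano plane, the first one taken three times. -/
def fanoVectors : Fin 9 → Fin 3 → ZMod 2 :=
  ![![1, 0, 0], ![0, 1, 0], ![0, 0, 1], ![0, 1, 1], ![1, 0, 0], ![1, 0, 0], ![1, 1, 0],
    ![1, 0, 1], ![1, 1, 1]]

/-- The binary encoding of `fanoVectors`. -/
def fanoCode : Fin 9 → ℕ := ![1, 2, 4, 6, 1, 1, 3, 5, 7]

theorem fanoVectors_ne_zero : ∀ i, fanoVectors i ≠ 0 := by decide +kernel

theorem fanoVectors_add_eq_zero_iff :
    ∀ i j, fanoVectors i + fanoVectors j = 0 ↔ fanoCode i = fanoCode j := by decide +kernel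

theorem fanoVectors_add_add_eq_zero_iff : ∀ i j k,
    fanoVectors i + fanoVectors j + fanoVectors k = 0 ↔ fanoCode i ^^^ fanoCode j = fanoCode k := by
  decide +kernel

/-- The matroid represented by `fanoVectors`. -/
def fanoMatroid : Matroid (Fin 9) := linearMatroid (ZMod 2) fanoVectors

instance : fanoMatroid.Finite := linearMatroid_finite _ _

/-- Vector addition becomes bitwise xor of the codes, a criterion that can be evaluated when bases
are enumerated. -/
theorem fanoMatroid_indep_iff {A : Finset (Fin 9)} (hA : A.card = 3) :
    fanoMatroid.Indep (A : Set (Fin 9)) ↔ ∀ x ∈ A, ∀ y ∈ A, x ≠ y → fanoCode x ≠ fanoCode y ∧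
      ∀ z ∈ A, z ≠ x → z ≠ y → fanoCode x ^^^ fanoCode y ≠ fanoCode z := by
  obtain ⟨i, j, k, hij, hik, hjk, rfl⟩ := Finset.card_eq_three.1 hA
  rw [fanoMatroid, linearMatroid_indep_iff, linearIndepOn_zmod_two_triple_iff _ hij hik hjk]
  simp only [ne_eq, fanoVectors_ne_zero, not_false_eq_true, and_self, true_and,
    fanoVectors_add_add_eq_zero_iff, fanoVectors_add_eq_zero_iff]
  constructor
  · rintro ⟨⟨h1, h2, h3⟩, h4⟩
    have h5 : fanoCode i ^^^ fanoCode k ≠ fanoCode j := by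
      rw [ne_eq, ← fanoVectors_add_add_eq_zero_iff, add_right_comm,
        fanoVectors_add_add_eq_zero_iff]
      exact h4
    have h6 : fanoCode j ^^^ fanoCode k ≠ fanoCode i := by
      rw [ne_eq, ← fanoVectors_add_add_eq_zero_iff, add_comm, ← add_assoc,
        fanoVectors_add_add_eq_zero_iff]
      exact h4
    have h4' := Nat.xor_comm (fanoCode i) (fanoCode j) ▸ h4
    have h5' := Nat.xor_comm (fanoCode i) (fanoCode k) ▸ h5
    have h6' := Nat.xor_comm (fanoCode j) (fanoCode k) ▸ h6
    grind
  · intro h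
    grind

theorem fanoMatroid_loopless : fanoMatroid.Loopless := by
  rw [Matroid.loopless_iff_forall_isNonloop]
  intro e _
  rw [← Matroid.indep_singleton, fanoMatroid, linearMatroid_indep_iff, linearIndepOn_singleton_iff]
  exact fanoVectors_ne_zero e

theorem rk_fanoMatroid : rk fanoMatroid = 3 := by
  have hind : fanoMatroid.Indep (({0, 1, 2} : Finset (Fin 9)) : Set (Fin 9)) := by
    rw [fanoMatroid_indep_iff (by decide)]
    decide +kernel
  obtain ⟨A, hA, hsub⟩ := hind.exists_isBase_superset
  rw [← ncard_eq_rk hA]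
  refine le_antisymm ?_ ?_
  · have h := (linearMatroid_indep_iff (ZMod 2) fanoVectors A).1 hA.indep
    have h1 := LinearIndependent.cardinalMk_le_finrank h
    rw [Module.finrank_fin_fun] at h1
    have := Cardinal.toNat_le_toNat h1 (Cardinal.natCast_lt_aleph0)
    simpa [← Nat.card_coe_set_eq, Nat.card] using this
  · have := Set.ncard_le_ncard hsub (Set.toFinite A)
    rwa [Set.ncard_coe_finset] at this

theorem B_fanoMatroid (R : Finset (Fin 9)) (a : ℕ) :
    B fanoMatroid (R : Set (Fin 9)) a =
      ({A ∈ Finset.powersetCard 3 Finset.univ |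
        (∀ x ∈ A, ∀ y ∈ A, x ≠ y → fanoCode x ≠ fanoCode y ∧
          ∀ z ∈ A, z ≠ x → z ≠ y → fanoCode x ^^^ fanoCode y ≠ fanoCode z) ∧
        (A ∩ R).card = a} : Finset (Finset (Fin 9))).card := by
  rw [B, ← Set.ncard_coe_finset, ← Set.ncard_image_of_injective _ Finset.coe_injective]
  congr 1
  ext A
  obtain ⟨A, rfl⟩ := (Set.toFinite A).exists_finset_coe
  rw [(Finset.coe_injective).mem_set_image]
  simp only [basesMeeting, Set.mem_ofPred_eq, isBase_iff_indep_ncard, rk_fanoMatroid,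
    Finset.coe_filter, Finset.mem_powersetCard, Finset.subset_univ, true_and,
    Set.ncard_coe_finset, ← Finset.coe_inter]
  constructor
  · rintro ⟨⟨h1, h2⟩, h3⟩
    exact ⟨h2, (fanoMatroid_indep_iff h2).1 h1, h3⟩
  · rintro ⟨h2, h1, h3⟩
    exact ⟨⟨(fanoMatroid_indep_iff h2).2 h1, h2⟩, h3⟩

theorem exists_partial_equality :
    ∃ (α : Type) (M : Matroid α) (R : Set α), M.Finite ∧ M.Loopless ∧ IsBinary M ∧
      2 ≤ rk M ∧ R ⊆ M.E ∧ 0 < P M R 0 ∧ 0 < P M R (rk M) ∧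
      (∃ a ∈ Set.Icc 1 (rk M - 1), SYEquality M R a) ∧
      ¬ ∀ a ∈ Set.Icc 1 (rk M - 1), SYEquality M R a := by
  -- R takes one copy of the tripled point e₁ together with the line {e₂, e₃, e₂ + e₃}. Dividing the
  -- counts 7, 21, 21, 3 by 1, 3, 3, 1 gives equality at a = 1 and strict inequality at a = 2.
  obtain ⟨R, hR⟩ : ∃ R : Finset (Fin 9), R = {0, 1, 2, 3} := ⟨_, rfl⟩
  have hB0 : B fanoMatroid R 0 = 7 := by rw [B_fanoMatroid, hR]; decide +kernel
  have hB1 : B fanoMatroid R 1 = 21 := by rw [B_fanoMatroid, hR]; decide +kernel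
  have hB2 : B fanoMatroid R 2 = 21 := by rw [B_fanoMatroid, hR]; decide +kernel
  have hB3 : B fanoMatroid R 3 = 3 := by rw [B_fanoMatroid, hR]; decide +kernel
  have hP0 : P fanoMatroid R 0 = 7 := by simp [P, hB0]
  have hP1 : P fanoMatroid R 1 = 7 := by rw [P, hB1, rk_fanoMatroid]; norm_num
  have hP2 : P fanoMatroid R 2 = 7 := by rw [P, hB2, rk_fanoMatroid]; norm_num [Nat.choose]
  have hP3 : P fanoMatroid R 3 = 3 := by rw [P, hB3, rk_fanoMatroid]; norm_num
  refine ⟨Fin 9, fanoMatroid, R, inferInstance, fanoMatroid_loopless,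
    ⟨3, fanoVectors, fun A _ => linearMatroid_indep_iff _ _ A⟩, ?_, Set.subset_univ _, ?_, ?_,
    ⟨1, ?_, ?_⟩, fun h => ?_⟩
  · rw [rk_fanoMatroid]; norm_num
  · rw [hP0]; norm_num
  · rw [rk_fanoMatroid, hP3]; norm_num
  · rw [rk_fanoMatroid]; simp
  · rw [SYEquality, hP1, hP2, hP0]; norm_num
  · have := h 2 (by rw [rk_fanoMatroid]; simp)
    rw [SYEquality, hP1, hP2, hP3] at this
    norm_num at this

end Example

end StanleyYan

open StanleyYan in
theorem theorem1p10 :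
    (∀ (α : Type*) (M : Matroid α) (R : Set α), M.Finite → M.Loopless → 2 ≤ rk M → R ⊆ M.E →
      0 < P M R 0 → 0 < P M R (rk M) →
      ((P M R 1 ^ rk M = P M R 0 ^ (rk M - 1) * P M R (rk M) ↔
          ∀ a ∈ Set.Icc 1 (rk M - 1), SYEquality M R a) ∧
        ((∀ a ∈ Set.Icc 1 (rk M - 1), SYEquality M R a) ↔
          ∃ s : ℝ, 0 < s ∧ ∀ x ∈ M.E,
            ((Par M x ∩ R).ncard : ℝ) = s * ((Par M x ∩ (M.E \ R)).ncard : ℝ)))) ∧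
    (∃ (α : Type) (M : Matroid α) (R : Set α), M.Finite ∧ M.Loopless ∧ IsBinary M ∧
      2 ≤ rk M ∧ R ⊆ M.E ∧ 0 < P M R 0 ∧ 0 < P M R (rk M) ∧
      (∃ a ∈ Set.Icc 1 (rk M - 1), SYEquality M R a) ∧
      ¬ ∀ a ∈ Set.Icc 1 (rk M - 1), SYEquality M R a) := by
  refine ⟨fun α M R hfin hM hr _ h0 h1 => ?_, exists_partial_equality⟩
  have := hfin
  exact equality_conditions_equivalent hM hr h0 h1
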